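/- Let $n\ge 3$. A parameter vector is a family $\vec p=(p_{i,j})_{i\ne j,\ i,j\in[n]}$ with $p_{i,j}\in(0,1)$ and $p_{i,j}+p_{j,i}=1$ for all $i\neq j$. It is called regular if $p_{i-1,i}\ge \tfrac12$ for $2\le i\le n$, $p_{i-1,j}\ge p_{i,j}$ for $2\le i<j\le n$, and $p_{i,j+1}\ge p_{i,j}$ for $1\le i<j\le n-1$. A label $c\in[n]$ is called neutral if $p_{c,i}=p_{i,c}=\tfrac12$ for all $i\ne c$; let $N(\vec p)$ be the number of neutral labels. Fill's adjacent-transposition chain on $\mathfrak S_n$ moves from $x=(x_1,\dots,x_n)$ as follows: a position $r\in\{1,\dots,n-1\}$ is chosen uniformly at random; with probability $p_{x_r,x_{r+1}}$ the chain stays at $x$, and with the remaining probability $p_{x_{r+1},x_r}$ the entries $x_r$ and $x_{r+1}$ are exchanged. Let $K(\vec p)$ be its transition matrix, whose eigenvalues are all real, let $\lambda_{K(\vec p)}=1-\beta$ be its spectral gap, where $\beta$ is the second largest eigenvalue of $K(\vec p)$, and let $$\lambda_*=\frac{1-\cos(\pi/n)}{n-1}.$$ Let $M(\vec p)$ be the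 algebraic multiplicity of $1-\lambda_*$ as an eigenvalue of $K(\vec p)$ (with $M(\vec p)=0$ if it is not an eigenvalue). **Theorem.** Let $n\ge 3$ and let $\vec p$ be a regular parameter vector. Then: 1. $\lambda_{K(\vec p)}=\lambda_*$ if and only if $N(\vec p)\ge 1$. 2. $M(\vec p)=N(\vec p)$ if $N(\vec p)\notin\{n-2,n\}$, and $M(\vec p)=n-1$ if $N(\vec p)\in\{n-2,n\}$. -/

import Mathlib

/-- A parameter vector on the label set `Fin n`: all `p i j` with `i ≠ j` lie in `(0, 1)`, and
`p i j + p j i = 1`. The diagonal entries are never used. -/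
structure IsParameterVector {n : ℕ} (p : Fin n → Fin n → ℝ) : Prop where
  pos : ∀ i j, i ≠ j → 0 < p i j
  lt_one : ∀ i j, i ≠ j → p i j < 1
  add_eq_one : ∀ i j, i ≠ j → p i j + p j i = 1

/-- A regular parameter vector. The labels are `0, …, n - 1` instead of `1, …, n`, and `i'` (`j'`)
is the label that follows `i` (`j`). -/
structure IsRegularParameterVector {n : ℕ} (p : Fin n → Fin n → ℝ) : Prop extends IsParameterVector p where
  half_le : ∀ i i' : Fin n, (i' : ℕ) = i + 1 → 1 / 2 ≤ p i i'
  mono_left : ∀ i i' j : Fin n, (i' : ℕ) = i + 1 → i' < j → p i' j ≤ p i j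
  mono_right : ∀ i j j' : Fin n, (j' : ℕ) = j + 1 → i < j → p i j ≤ p i j'

/-- The label `c` is neutral for `p`. -/
def IsNeutral {n : ℕ} (p : Fin n → Fin n → ℝ) (c : Fin n) : Prop :=
  ∀ i, i ≠ c → p c i = 1 / 2 ∧ p i c = 1 / 2

/-- The number `N(p)` of neutral labels. -/
noncomputable def numNeutral {n : ℕ} (p : Fin n → Fin n → ℝ) : ℕ :=
  Set.ncard {c : Fin n | IsNeutral p c}

/-- The first of the two adjacent positions exchanged by the `r`-th transposition. -/
def leftPos {n : ℕ} (r : Fin (n - 1)) : Fin n := ⟨r, by omega⟩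

/-- The second of the two adjacent positions exchanged by the `r`-th transposition. -/
def rightPos {n : ℕ} (r : Fin (n - 1)) : Fin n := ⟨r + 1, by omega⟩

/-- A state is a permutation `x`, where `x k` is the label in position `k` (one-line notation);
`adjSwap x r` exchanges the labels in the adjacent positions `r` and `r + 1`. -/
def adjSwap {n : ℕ} (x : Equiv.Perm (Fin n)) (r : Fin (n - 1)) : Equiv.Perm (Fin n) :=
  x * Equiv.swap (leftPos r) (rightPos r)

/-- The transition matrix `E_r` of the update at the positions `r` and `r + 1`. -/
noncomputable def updateMatrix {n : ℕ} (p : Fin n → Fin n → ℝ) (r : Fin (n - 1)) :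
    Matrix (Equiv.Perm (Fin n)) (Equiv.Perm (Fin n)) ℝ :=
  Matrix.of fun x y =>
    if y = x then p (x (leftPos r)) (x (rightPos r))
    else if y = adjSwap x r then p (x (rightPos r)) (x (leftPos r))
    else 0

/-- The transition matrix `K(p)` of the adjacent-transposition chain. -/
noncomputable def transitionMatrix {n : ℕ} (p : Fin n → Fin n → ℝ) :
    Matrix (Equiv.Perm (Fin n)) (Equiv.Perm (Fin n)) ℝ :=
  (1 / ((n : ℝ) - 1)) • ∑ r : Fin (n - 1), updateMatrix p r

/-- The second entry of the decreasing list of real eigenvalues, repeated according to algebraic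
multiplicity. (The chain is reversible, so `K(p)` has `n!` real eigenvalues, and the default value
`0` is not used for `2 ≤ n`.) -/
noncomputable def secondLargestEigenvalue {ι : Type*} [Fintype ι] [DecidableEq ι]
    (A : Matrix ι ι ℝ) : ℝ :=
  (A.charpoly.roots.sort (· ≥ ·)).getD 1 0

/-- The spectral gap `1 - β`, where `β` is the second largest eigenvalue of `K(p)`. -/
noncomputable def spectralGap {n : ℕ} (p : Fin n → Fin n → ℝ) : ℝ :=
  1 - secondLargestEigenvalue (transitionMatrix p)

/-- The value `λ* = (1 - cos (π / n)) / (n - 1)`. -/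
noncomputable def gapStar (n : ℕ) : ℝ :=
  (1 - Real.cos (Real.pi / n)) / ((n : ℝ) - 1)

/-- The algebraic multiplicity `M(p)` of `1 - λ*` as an eigenvalue of `K(p)`. -/
noncomputable def gapMultiplicity {n : ℕ} (p : Fin n → Fin n → ℝ) : ℕ :=
  (transitionMatrix p).charpoly.rootMultiplicity (1 - gapStar n)

/-! Let `P_r` be `coproj p r`, the complement of the update at positions `r`, `r + 1`, and `D = ∑
P_r`, so `K = 1 - D / (n - 1)`. The `P_r` are orthogonal projections for the reversible weight. With
`γ = 1 - cos (π / n)`, the gap bound is `D² ≥ γ D` (`spectral_inequality`). Expand `⟨Df, Df⟩` over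
pairs `(r, s)`. Projections that are far apart commute, so their terms are nonnegative. For
neighbours, `P_r P_s P_r = c P_r + (1 - c) Q`, where `Q` projects onto the common range and `c` is
the probability of a cyclic tournament on the three labels involved (`coproj_coproj_coproj`).
Regularity gives `c ≤ 1/4`, and completing a square (`consecutive_energy_eq`) yields `2⟨P_r f, P_s
f⟩ ≥ -(t‖P_r f‖² + t⁻¹‖P_s f‖²)/2` for all `t > 0`. With `t` a ratio of entries of the Perron vector
of the path, whose eigenvalue is `2 cos (π / n)`, the losses add up to `cos (π / n) ∑ ‖P_r f‖²`.

If `Df = γ f`, every pair estimate is an equality (`IsTight`). Then the change of `f` under the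
first swap depends only on the two labels exchanged, and the changes around three labels sum to
zero, so the change has the form `v a - v b`. If some label besides the two extreme ones is not
neutral, equality in `c ≤ 1/4` kills the change for two non-neutral labels
(`IsTight.vanishesOutside_neutral`). Neutrality carries the changes along the positions in
proportion to the Perron vector, which forces `f = labelSum w` with `w` supported on neutral labels
(`exists_eq_labelSum`). Conversely, a neutral label performs a symmetric walk, so these functions
are eigenfunctions, and the multiplicity is the number of neutral labels. If all labels but the two
extreme ones are neutral, `pairFun` supplies one further dimension: `(n - 2) + 1 = n - 1`. Finally,
`1` is a simple eigenvalue and all others are at most `1 - λ*`, so the gap equals `λ*` exactly when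
`1 - λ*` is an eigenvalue. -/

open Finset

/-! ### Adjacent transpositions and their commutation. -/

section AdjSwap

variable {n : ℕ}

theorem val_leftPos (r : Fin (n - 1)) : (leftPos r : ℕ) = r := rfl

theorem val_rightPos (r : Fin (n - 1)) : (rightPos r : ℕ) = r + 1 := rfl

theorem leftPos_ne_rightPos (r : Fin (n - 1)) : leftPos r ≠ rightPos r := by
  intro h
  have := congrArg Fin.val h
  simp [leftPos, rightPos] at this

theorem leftPos_lt_rightPos (r : Fin (n - 1)) : leftPos r < rightPos r := by
  simp [leftPos, rightPos, Fin.lt_def]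

theorem adjSwap_apply (x : Equiv.Perm (Fin n)) (r : Fin (n - 1)) (k : Fin n) :
    adjSwap x r k = x (Equiv.swap (leftPos r) (rightPos r) k) := rfl

@[simp] theorem adjSwap_leftPos (x : Equiv.Perm (Fin n)) (r : Fin (n - 1)) :
    adjSwap x r (leftPos r) = x (rightPos r) := by simp [adjSwap_apply]

@[simp] theorem adjSwap_rightPos (x : Equiv.Perm (Fin n)) (r : Fin (n - 1)) :
    adjSwap x r (rightPos r) = x (leftPos r) := by simp [adjSwap_apply]

theorem adjSwap_of_ne (x : Equiv.Perm (Fin n)) (r : Fin (n - 1)) {k : Fin n}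
    (h₁ : (k : ℕ) ≠ r) (h₂ : (k : ℕ) ≠ r + 1) : adjSwap x r k = x k := by
  rw [adjSwap_apply, Equiv.swap_apply_of_ne_of_ne]
  · exact fun h => h₁ (congrArg Fin.val h)
  · exact fun h => h₂ (congrArg Fin.val h)

@[simp] theorem adjSwap_adjSwap (x : Equiv.Perm (Fin n)) (r : Fin (n - 1)) :
    adjSwap (adjSwap x r) r = x := by
  simp [adjSwap, mul_assoc]

theorem adjSwap_symm_apply (x : Equiv.Perm (Fin n)) (r : Fin (n - 1)) (c : Fin n) :
    (adjSwap x r).symm c = Equiv.swap (leftPos r) (rightPos r) (x.symm c) := by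
  rw [Equiv.symm_apply_eq, adjSwap_apply, Equiv.swap_apply_self, Equiv.apply_symm_apply]

theorem adjSwap_ne (x : Equiv.Perm (Fin n)) (r : Fin (n - 1)) : adjSwap x r ≠ x := by
  intro h
  have := congrArg (fun y : Equiv.Perm (Fin n) => y (leftPos r)) h
  simp only [adjSwap_leftPos] at this
  exact leftPos_ne_rightPos r (x.injective this).symm

/-- The positions exchanged by the transpositions `r` and `s` are disjoint. -/
def FarApart (r s : Fin (n - 1)) : Prop := (r : ℕ) + 1 < s ∨ (s : ℕ) + 1 < r

theorem FarApart.symm {r s : Fin (n - 1)} (h : FarApart r s) : FarApart s r := Or.symm h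

theorem FarApart.adjSwap_leftPos {r s : Fin (n - 1)} (h : FarApart r s)
    (x : Equiv.Perm (Fin n)) : adjSwap x s (leftPos r) = x (leftPos r) := by
  apply adjSwap_of_ne <;> simp only [leftPos] <;> rcases h with h | h <;> omega

theorem FarApart.adjSwap_rightPos {r s : Fin (n - 1)} (h : FarApart r s)
    (x : Equiv.Perm (Fin n)) : adjSwap x s (rightPos r) = x (rightPos r) := by
  apply adjSwap_of_ne <;> simp only [rightPos] <;> rcases h with h | h <;> omega

theorem FarApart.adjSwap_comm {r s : Fin (n - 1)} (h : FarApart r s)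
    (x : Equiv.Perm (Fin n)) : adjSwap (adjSwap x s) r = adjSwap (adjSwap x r) s := by
  ext k : 1
  have key : ∀ {r s : Fin (n - 1)}, FarApart r s → ∀ k : Fin n, ((k : ℕ) = r ∨ (k : ℕ) = r + 1) →
      adjSwap (adjSwap x s) r k = adjSwap (adjSwap x r) s k := by
    intro r s h k hk
    rcases hk with hk | hk
    · obtain rfl : k = leftPos r := Fin.ext hk
      rw [_root_.adjSwap_leftPos, h.adjSwap_rightPos, h.adjSwap_leftPos, _root_.adjSwap_leftPos]
    · obtain rfl : k = rightPos r := Fin.ext hk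
      rw [_root_.adjSwap_rightPos, h.adjSwap_rightPos, h.adjSwap_leftPos, _root_.adjSwap_rightPos]
  by_cases h₁ : (k : ℕ) = r ∨ (k : ℕ) = r + 1
  · exact key h k h₁
  by_cases h₂ : (k : ℕ) = s ∨ (k : ℕ) = s + 1
  · exact (key h.symm k h₂).symm
  push Not at h₁ h₂
  rw [adjSwap_of_ne _ _ h₁.1 h₁.2, adjSwap_of_ne _ _ h₂.1 h₂.2, adjSwap_of_ne _ _ h₂.1 h₂.2,
    adjSwap_of_ne _ _ h₁.1 h₁.2]

/-- Summation over the states is invariant under an adjacent transposition. -/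
theorem sum_adjSwap (r : Fin (n - 1)) (F : Equiv.Perm (Fin n) → ℝ) :
    ∑ x, F (adjSwap x r) = ∑ x, F x :=
  Fintype.sum_bijective (fun x => adjSwap x r)
    (Function.Involutive.bijective fun x => adjSwap_adjSwap x r) _ _ fun _ => rfl

end AdjSwap

/-! ### The reversible measure. -/

section Weight

variable {n : ℕ} {p : Fin n → Fin n → ℝ}

/-- An unnormalized reversible measure of the chain. -/
noncomputable def statWeight (p : Fin n → Fin n → ℝ) (x : Equiv.Perm (Fin n)) : ℝ :=
  ∏ q : Fin n × Fin n with q.1 < q.2, p (x q.1) (x q.2)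

theorem statWeight_pos (hp : IsParameterVector p) (x : Equiv.Perm (Fin n)) :
    0 < statWeight p x := by
  refine Finset.prod_pos fun q hq => hp.pos _ _ fun h => ?_
  have := x.injective h
  simp only [mem_filter, mem_univ, true_and] at hq
  exact absurd this hq.ne

theorem swap_lt_swap {r : Fin (n - 1)} {i j : Fin n} (hij : i < j)
    (hne : (i, j) ≠ (leftPos r, rightPos r)) :
    Equiv.swap (leftPos r) (rightPos r) i < Equiv.swap (leftPos r) (rightPos r) j := by
  simp only [ne_eq, Prod.mk.injEq, not_and, Fin.ext_iff, leftPos, rightPos] at hne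
  simp only [Equiv.swap_apply_def, Fin.ext_iff, leftPos, rightPos, Fin.lt_def] at *
  split_ifs <;> simp <;> omega

/-- Detailed balance: the transposition permutes the other ordered pairs of positions, so the two
products differ in a single factor. -/
theorem statWeight_adjSwap (p : Fin n → Fin n → ℝ) (x : Equiv.Perm (Fin n)) (r : Fin (n - 1)) :
    statWeight p (adjSwap x r) * p (x (leftPos r)) (x (rightPos r)) =
      statWeight p x * p (x (rightPos r)) (x (leftPos r)) := by
  have hmem : (leftPos r, rightPos r) ∈ ({q | q.1 < q.2} : Finset (Fin n × Fin n)) := by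
    simp [leftPos_lt_rightPos]
  have hmaps : ∀ q ∈ ({q | q.1 < q.2} : Finset (Fin n × Fin n)).erase (leftPos r, rightPos r),
      Prod.map (Equiv.swap (leftPos r) (rightPos r)) (Equiv.swap (leftPos r) (rightPos r)) q ∈
        ({q | q.1 < q.2} : Finset (Fin n × Fin n)).erase (leftPos r, rightPos r) := by
    rintro ⟨i, j⟩ hq
    simp only [mem_erase, mem_filter, mem_univ, true_and, Prod.map] at hq ⊢
    refine ⟨fun h => ?_, swap_lt_swap hq.2 hq.1⟩
    simp only [Prod.mk.injEq, Equiv.swap_apply_eq_iff, Equiv.swap_apply_left,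
      Equiv.swap_apply_right] at h
    rw [h.1, h.2] at hq
    exact absurd hq.2 (leftPos_lt_rightPos r).not_gt
  have hrest : ∏ q ∈ ({q | q.1 < q.2} : Finset (Fin n × Fin n)).erase (leftPos r, rightPos r),
        p (adjSwap x r q.1) (adjSwap x r q.2) =
      ∏ q ∈ ({q | q.1 < q.2} : Finset (Fin n × Fin n)).erase (leftPos r, rightPos r),
        p (x q.1) (x q.2) := by
    refine Finset.prod_nbij' (Prod.map (Equiv.swap (leftPos r) (rightPos r))
      (Equiv.swap (leftPos r) (rightPos r))) (Prod.map (Equiv.swap (leftPos r) (rightPos r))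
      (Equiv.swap (leftPos r) (rightPos r))) hmaps hmaps ?_ ?_ ?_
    · rintro ⟨i, j⟩ _; simp [Prod.map]
    · rintro ⟨i, j⟩ _; simp [Prod.map]
    · intro q _; rfl
  unfold statWeight
  rw [← Finset.mul_prod_erase _ _ hmem, ← Finset.mul_prod_erase _ _ hmem, hrest]
  simp only [adjSwap_leftPos, adjSwap_rightPos]
  ring

end Weight

/-! ### The projections complementary to the updates. -/

section Operators

variable {n : ℕ} {p : Fin n → Fin n → ℝ}

/-- The change of `f` under the `r`-th adjacent transposition. -/
def diffAt (r : Fin (n - 1)) (f : Equiv.Perm (Fin n) → ℝ) (x : Equiv.Perm (Fin n)) : ℝ :=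
  f x - f (adjSwap x r)

theorem diffAt_adjSwap (r : Fin (n - 1)) (f : Equiv.Perm (Fin n) → ℝ) (x : Equiv.Perm (Fin n)) :
    diffAt r f (adjSwap x r) = -diffAt r f x := by
  simp [diffAt]

/-- The projection `1 - E_r` complementary to the update at the positions `r` and `r + 1`. -/
def coproj (p : Fin n → Fin n → ℝ) (r : Fin (n - 1)) (f : Equiv.Perm (Fin n) → ℝ)
    (x : Equiv.Perm (Fin n)) : ℝ :=
  p (x (rightPos r)) (x (leftPos r)) * diffAt r f x

theorem IsParameterVector.add_eq_one_apply (hp : IsParameterVector p) (x : Equiv.Perm (Fin n))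
    {i j : Fin n} (h : i ≠ j) : p (x i) (x j) = 1 - p (x j) (x i) := by
  linarith [hp.add_eq_one (x i) (x j) (fun e => h (x.injective e))]

theorem IsParameterVector.label_pos (hp : IsParameterVector p) (x : Equiv.Perm (Fin n))
    {i j : Fin n} (h : i ≠ j) : 0 < p (x i) (x j) :=
  hp.pos _ _ fun e => h (x.injective e)

theorem updateMatrix_mulVec (hp : IsParameterVector p) (r : Fin (n - 1))
    (f : Equiv.Perm (Fin n) → ℝ) : (updateMatrix p r).mulVec f = f - coproj p r f := by
  ext x
  have h : ∀ y, updateMatrix p r x y * f y =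
      (if y = x then p (x (leftPos r)) (x (rightPos r)) * f x else 0) +
      (if y = adjSwap x r then p (x (rightPos r)) (x (leftPos r)) * f (adjSwap x r) else 0) := by
    intro y
    simp only [updateMatrix, Matrix.of_apply]
    by_cases h₁ : y = x
    · subst h₁; simp [(adjSwap_ne y r).symm]
    · by_cases h₂ : y = adjSwap x r <;> simp [h₁, h₂, adjSwap_ne]
  simp only [Matrix.mulVec, dotProduct, h, sum_add_distrib, sum_ite_eq', mem_univ, if_true,
    Pi.sub_apply, coproj, diffAt]
  rw [hp.add_eq_one_apply x (leftPos_ne_rightPos r)]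
  ring

theorem transitionMatrix_mulVec (hn : 2 ≤ n) (hp : IsParameterVector p)
    (f : Equiv.Perm (Fin n) → ℝ) :
    (transitionMatrix p).mulVec f =
      f - (1 / ((n : ℝ) - 1)) • ∑ r, coproj p r f := by
  have hn' : (n : ℝ) - 1 ≠ 0 := by
    have : (2 : ℝ) ≤ n := by exact_mod_cast hn
    linarith
  rw [transitionMatrix, Matrix.smul_mulVec, Matrix.sum_mulVec]
  simp only [updateMatrix_mulVec hp, sum_sub_distrib, sum_const, card_univ, Fintype.card_fin]
  rw [smul_sub, ← Nat.cast_smul_eq_nsmul ℝ, smul_smul, Nat.cast_sub (by omega), Nat.cast_one,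
    one_div_mul_cancel hn', one_smul]

theorem coproj_coproj (hp : IsParameterVector p) (r : Fin (n - 1))
    (f : Equiv.Perm (Fin n) → ℝ) : coproj p r (coproj p r f) = coproj p r f := by
  ext x
  simp only [coproj, diffAt, adjSwap_leftPos, adjSwap_rightPos, adjSwap_adjSwap]
  rw [hp.add_eq_one_apply x (leftPos_ne_rightPos r)]
  ring

theorem coproj_mul_of_invariant (r : Fin (n - 1)) (f m : Equiv.Perm (Fin n) → ℝ)
    (hm : ∀ x, m (adjSwap x r) = m x) : coproj p r (m * f) = m * coproj p r f := by
  ext x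
  simp only [coproj, diffAt, Pi.mul_apply, hm]
  ring

theorem coproj_comm {r s : Fin (n - 1)} (h : FarApart r s) (f : Equiv.Perm (Fin n) → ℝ) :
    coproj p r (coproj p s f) = coproj p s (coproj p r f) := by
  ext x
  simp only [coproj, diffAt, h.adjSwap_leftPos, h.adjSwap_rightPos, h.symm.adjSwap_leftPos,
    h.symm.adjSwap_rightPos, h.adjSwap_comm]
  ring

/-- The inner product with respect to the reversible measure. -/
noncomputable def statInner (p : Fin n → Fin n → ℝ) (f g : Equiv.Perm (Fin n) → ℝ) : ℝ :=
  ∑ x, statWeight p x * f x * g x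

theorem statInner_comm (f g : Equiv.Perm (Fin n) → ℝ) : statInner p f g = statInner p g f :=
  Finset.sum_congr rfl fun x _ => by ring

theorem statInner_add_left (f g h : Equiv.Perm (Fin n) → ℝ) :
    statInner p (f + g) h = statInner p f h + statInner p g h := by
  simp only [statInner, ← sum_add_distrib]
  exact Finset.sum_congr rfl fun x _ => by simp only [Pi.add_apply]; ring

theorem statInner_smul_left (c : ℝ) (f h : Equiv.Perm (Fin n) → ℝ) :
    statInner p (c • f) h = c * statInner p f h := by
  simp only [statInner, mul_sum]
  exact Finset.sum_congr rfl fun x _ => by simp only [Pi.smul_apply, smul_eq_mul]; ring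

theorem statInner_add_right (f g h : Equiv.Perm (Fin n) → ℝ) :
    statInner p h (f + g) = statInner p h f + statInner p h g := by
  simp only [statInner_comm h, statInner_add_left]

theorem statInner_smul_right (c : ℝ) (f h : Equiv.Perm (Fin n) → ℝ) :
    statInner p h (c • f) = c * statInner p h f := by
  simp only [statInner_comm h, statInner_smul_left]

theorem statInner_sum_left {ι : Type*} (s : Finset ι) (F : ι → Equiv.Perm (Fin n) → ℝ)
    (h : Equiv.Perm (Fin n) → ℝ) :
    statInner p (∑ i ∈ s, F i) h = ∑ i ∈ s, statInner p (F i) h := by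
  simp only [statInner, Finset.sum_apply, mul_sum, sum_mul]
  exact Finset.sum_comm

theorem statInner_sum_right {ι : Type*} (s : Finset ι) (F : ι → Equiv.Perm (Fin n) → ℝ)
    (h : Equiv.Perm (Fin n) → ℝ) :
    statInner p h (∑ i ∈ s, F i) = ∑ i ∈ s, statInner p h (F i) := by
  simp only [statInner_comm h, statInner_sum_left]

theorem statInner_mul_left (m f g : Equiv.Perm (Fin n) → ℝ) :
    statInner p (m * f) g = statInner p f (m * g) :=
  Finset.sum_congr rfl fun x _ => by simp only [Pi.mul_apply]; ring

theorem statInner_mul_self_nonneg (hp : IsParameterVector p) {m : Equiv.Perm (Fin n) → ℝ}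
    (hm : ∀ x, 0 ≤ m x) (f : Equiv.Perm (Fin n) → ℝ) : 0 ≤ statInner p (m * f) f := by
  refine Finset.sum_nonneg fun x _ => ?_
  have := mul_nonneg (mul_nonneg (statWeight_pos hp x).le (hm x)) (mul_self_nonneg (f x))
  simp only [Pi.mul_apply]
  linarith

theorem eq_zero_of_statInner_mul_self (hp : IsParameterVector p) {m : Equiv.Perm (Fin n) → ℝ}
    (hm : ∀ x, 0 ≤ m x) {f : Equiv.Perm (Fin n) → ℝ} (h : statInner p (m * f) f = 0)
    (x : Equiv.Perm (Fin n)) (hx : m x ≠ 0) : f x = 0 := by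
  have h₀ : ∀ x ∈ (univ : Finset (Equiv.Perm (Fin n))),
      0 ≤ statWeight p x * (m * f) x * f x := fun x _ => by
    have := mul_nonneg (mul_nonneg (statWeight_pos hp x).le (hm x)) (mul_self_nonneg (f x))
    simp only [Pi.mul_apply]
    linarith
  have := (Finset.sum_eq_zero_iff_of_nonneg h₀).1 h x (mem_univ x)
  simp only [Pi.mul_apply, mul_eq_zero, (statWeight_pos hp x).ne', hx, false_or, or_self] at this
  exact this

theorem statInner_self_nonneg (hp : IsParameterVector p) (f : Equiv.Perm (Fin n) → ℝ) :
    0 ≤ statInner p f f := by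
  simpa using statInner_mul_self_nonneg hp (m := 1) (fun _ => zero_le_one) f

theorem statInner_self_eq_zero (hp : IsParameterVector p) {f : Equiv.Perm (Fin n) → ℝ}
    (h : statInner p f f = 0) : f = 0 := by
  ext x
  exact eq_zero_of_statInner_mul_self hp (m := 1) (fun _ => zero_le_one) (by simpa using h) x
    (by simp)

/-- Reversibility: the edge weight `k` agrees at both ends of a swap, so reindexing by the swap
moves the cross term from one argument to the other. -/
theorem statInner_coproj_left (p : Fin n → Fin n → ℝ) (r : Fin (n - 1))
    (f g : Equiv.Perm (Fin n) → ℝ) :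
    statInner p (coproj p r f) g = statInner p f (coproj p r g) := by
  set k : Equiv.Perm (Fin n) → ℝ := fun x =>
    statWeight p x * p (x (rightPos r)) (x (leftPos r)) with hk
  have hkinv : ∀ x, k (adjSwap x r) = k x := fun x => by
    simp only [hk, adjSwap_leftPos, adjSwap_rightPos]
    exact statWeight_adjSwap p x r
  have h := sum_adjSwap r fun x => k x * f x * g (adjSwap x r)
  simp only [hkinv, adjSwap_adjSwap] at h
  calc statInner p (coproj p r f) g
      = ∑ x, (k x * f x * g x - k x * f (adjSwap x r) * g x) :=
        Finset.sum_congr rfl fun x _ => by simp only [coproj, diffAt, hk]; ring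
    _ = ∑ x, (k x * f x * g x - k x * f x * g (adjSwap x r)) := by
        rw [sum_sub_distrib, sum_sub_distrib, h]
    _ = statInner p f (coproj p r g) :=
        Finset.sum_congr rfl fun x _ => by simp only [coproj, diffAt, hk]; ring

end Operators

/-! ### Two consecutive projections on the six orderings of three labels. -/

section Block

set_option linter.unusedSimpArgs false

variable {n : ℕ} {p : Fin n → Fin n → ℝ} {r s : Fin (n - 1)}

theorem leftPos_of_succ (h : (s : ℕ) = r + 1) : leftPos s = rightPos r :=
  Fin.ext h

theorem adjSwap_succ_leftPos (h : (s : ℕ) = r + 1) (x : Equiv.Perm (Fin n)) :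
    adjSwap x s (leftPos r) = x (leftPos r) := by
  apply adjSwap_of_ne <;> simp only [leftPos] <;> omega

theorem adjSwap_succ_middle (h : (s : ℕ) = r + 1) (x : Equiv.Perm (Fin n)) :
    adjSwap x s (rightPos r) = x (rightPos s) := by
  rw [← leftPos_of_succ h, adjSwap_leftPos]

theorem adjSwap_succ_right (h : (s : ℕ) = r + 1) (x : Equiv.Perm (Fin n)) :
    adjSwap x s (rightPos s) = x (rightPos r) := by
  rw [← leftPos_of_succ h, adjSwap_rightPos]

theorem adjSwap_pred_rightPos (h : (s : ℕ) = r + 1) (x : Equiv.Perm (Fin n)) :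
    adjSwap x r (rightPos s) = x (rightPos s) := by
  apply adjSwap_of_ne <;> simp only [rightPos] <;> omega

theorem adjSwap_braid (h : (s : ℕ) = r + 1) (x : Equiv.Perm (Fin n)) :
    adjSwap (adjSwap (adjSwap x s) r) s = adjSwap (adjSwap (adjSwap x r) s) r := by
  ext k : 1
  by_cases h₁ : (k : ℕ) = r
  · obtain rfl : k = leftPos r := Fin.ext h₁
    simp only [adjSwap_leftPos, adjSwap_rightPos, adjSwap_succ_leftPos h, adjSwap_succ_middle h,
      adjSwap_succ_right h, adjSwap_pred_rightPos h]
  by_cases h₂ : (k : ℕ) = r + 1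
  · obtain rfl : k = rightPos r := Fin.ext h₂
    simp only [adjSwap_leftPos, adjSwap_rightPos, adjSwap_succ_leftPos h, adjSwap_succ_middle h,
      adjSwap_succ_right h, adjSwap_pred_rightPos h]
  by_cases h₃ : (k : ℕ) = s + 1
  · obtain rfl : k = rightPos s := Fin.ext h₃
    simp only [adjSwap_leftPos, adjSwap_rightPos, adjSwap_succ_leftPos h, adjSwap_succ_middle h,
      adjSwap_succ_right h, adjSwap_pred_rightPos h]
  · simp only [adjSwap_of_ne _ _ h₁ h₂, adjSwap_of_ne _ s (h ▸ h₂) h₃]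

/-- The probability that the tournament on three labels given by `p` is a cycle. It is the square
of the cosine of the angle between two consecutive updates on these labels. -/
def cycleProb (p : Fin n → Fin n → ℝ) (a b c : Fin n) : ℝ :=
  p a b * p b c * p c a + p b a * p c b * p a c

/-- `cycleProb` for the labels at the positions of two consecutive transpositions. -/
def blockCoef (p : Fin n → Fin n → ℝ) (r s : Fin (n - 1)) (x : Equiv.Perm (Fin n)) : ℝ :=
  cycleProb p (x (leftPos r)) (x (rightPos r)) (x (rightPos s))

theorem blockCoef_adjSwap_left (h : (s : ℕ) = r + 1) (x : Equiv.Perm (Fin n)) :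
    blockCoef p r s (adjSwap x r) = blockCoef p r s x := by
  simp only [blockCoef, cycleProb, adjSwap_leftPos, adjSwap_rightPos, adjSwap_pred_rightPos h]
  ring

theorem blockCoef_adjSwap_right (h : (s : ℕ) = r + 1) (x : Equiv.Perm (Fin n)) :
    blockCoef p r s (adjSwap x s) = blockCoef p r s x := by
  simp only [blockCoef, cycleProb, adjSwap_succ_leftPos h, adjSwap_succ_middle h,
    adjSwap_succ_right h]
  ring

/-- The projection onto the common range of two consecutive projections `coproj p r` and
`coproj p s`. -/
noncomputable def blockProj (p : Fin n → Fin n → ℝ) (r s : Fin (n - 1))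
    (f : Equiv.Perm (Fin n) → ℝ) (x : Equiv.Perm (Fin n)) : ℝ :=
  (1 - blockCoef p r s x)⁻¹ *
    (p (x (rightPos r)) (x (leftPos r)) * p (x (rightPos s)) (x (leftPos r)) *
      p (x (rightPos s)) (x (rightPos r)) *
      (f x - f (adjSwap x r) - f (adjSwap x s) + f (adjSwap (adjSwap x r) s) +
        f (adjSwap (adjSwap x s) r) - f (adjSwap (adjSwap (adjSwap x r) s) r)))

theorem leftPos_ne_rightPos_succ (h : (s : ℕ) = r + 1) : leftPos r ≠ rightPos s := by
  intro e; have := congrArg Fin.val e; simp [leftPos, rightPos] at this; omega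

theorem rightPos_ne_rightPos_succ (h : (s : ℕ) = r + 1) : rightPos r ≠ rightPos s := by
  intro e; have := congrArg Fin.val e; simp [rightPos] at this; omega

/-- On six orderings both projections have rank three. They share a line of constants as kernel and
a line as range; on the remaining four dimensions they meet at one angle with squared cosine
`blockCoef`. The total mass `1 - blockCoef` of the six transitive tournaments normalizes
`blockProj`. -/
theorem coproj_coproj_coproj (hp : IsParameterVector p) (h : (s : ℕ) = r + 1)
    (hs : ∀ x, blockCoef p r s x ≠ 1) (f : Equiv.Perm (Fin n) → ℝ) :
    coproj p r (coproj p s (coproj p r f)) =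
      blockCoef p r s * coproj p r f + (1 - blockCoef p r s) * blockProj p r s f := by
  ext x
  have hx : 1 - blockCoef p r s x ≠ 0 := sub_ne_zero.2 (hs x).symm
  simp only [Pi.add_apply, Pi.mul_apply, Pi.sub_apply, Pi.one_apply, blockProj]
  rw [mul_inv_cancel_left₀ hx]
  simp only [blockCoef, cycleProb, coproj, diffAt, leftPos_of_succ h, adjSwap_leftPos,
    adjSwap_rightPos, adjSwap_succ_leftPos h, adjSwap_succ_middle h, adjSwap_succ_right h,
    adjSwap_pred_rightPos h, adjSwap_adjSwap, adjSwap_braid h]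
  rw [hp.add_eq_one_apply x (leftPos_ne_rightPos r), hp.add_eq_one_apply x (leftPos_ne_rightPos_succ h),
    hp.add_eq_one_apply x (rightPos_ne_rightPos_succ h)]
  ring

theorem coproj_left_blockProj (hp : IsParameterVector p) (h : (s : ℕ) = r + 1)
    (f : Equiv.Perm (Fin n) → ℝ) :
    coproj p r (blockProj p r s f) = blockProj p r s f := by
  ext x
  simp only [blockProj, coproj, diffAt, blockCoef_adjSwap_left h]
  simp only [adjSwap_leftPos,
    adjSwap_rightPos, adjSwap_succ_leftPos h, adjSwap_succ_middle h, adjSwap_succ_right h,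
    adjSwap_pred_rightPos h, adjSwap_adjSwap, adjSwap_braid h]
  rw [hp.add_eq_one_apply x (leftPos_ne_rightPos r)]
  ring

theorem coproj_right_blockProj (hp : IsParameterVector p) (h : (s : ℕ) = r + 1)
    (f : Equiv.Perm (Fin n) → ℝ) :
    coproj p s (blockProj p r s f) = blockProj p r s f := by
  ext x
  simp only [blockProj, coproj, diffAt, blockCoef_adjSwap_right h]
  simp only [leftPos_of_succ h, adjSwap_leftPos,
    adjSwap_rightPos, adjSwap_succ_leftPos h, adjSwap_succ_middle h, adjSwap_succ_right h,
    adjSwap_pred_rightPos h, adjSwap_adjSwap, adjSwap_braid h]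
  rw [hp.add_eq_one_apply x (rightPos_ne_rightPos_succ h)]
  ring

theorem one_sub_blockCoef_mul_blockProj (hp : IsParameterVector p) (h : (s : ℕ) = r + 1)
    (hs : ∀ x, blockCoef p r s x ≠ 1) (f : Equiv.Perm (Fin n) → ℝ) :
    (1 - blockCoef p r s) * blockProj p r s f =
      coproj p r (coproj p s (coproj p r f)) + (-1 : ℝ) • (blockCoef p r s * coproj p r f) := by
  rw [coproj_coproj_coproj hp h hs]
  module

/-- Writing the projection through `coproj` and multipliers invariant under both swaps lets it
inherit idempotence and self-adjointness. -/
theorem blockProj_eq (hp : IsParameterVector p) (h : (s : ℕ) = r + 1)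
    (hs : ∀ x, blockCoef p r s x ≠ 1) (f : Equiv.Perm (Fin n) → ℝ) :
    blockProj p r s f = (1 - blockCoef p r s)⁻¹ *
      (coproj p r (coproj p s (coproj p r f)) + (-1 : ℝ) • (blockCoef p r s * coproj p r f)) := by
  rw [← one_sub_blockCoef_mul_blockProj hp h hs]
  ext x
  have hx : 1 - blockCoef p r s x ≠ 0 := sub_ne_zero.2 (hs x).symm
  simp [inv_mul_cancel_left₀ hx]

theorem blockProj_blockProj (hp : IsParameterVector p) (h : (s : ℕ) = r + 1)
    (hs : ∀ x, blockCoef p r s x ≠ 1) (f : Equiv.Perm (Fin n) → ℝ) :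
    blockProj p r s (blockProj p r s f) = blockProj p r s f := by
  rw [blockProj_eq hp h hs (blockProj p r s f)]
  simp only [coproj_left_blockProj hp h, coproj_right_blockProj hp h]
  ext x
  have hx : 1 - blockCoef p r s x ≠ 0 := sub_ne_zero.2 (hs x).symm
  simp only [Pi.mul_apply, Pi.inv_apply, Pi.sub_apply, Pi.one_apply, Pi.add_apply, Pi.smul_apply,
    smul_eq_mul]
  field_simp
  ring

theorem blockProj_blockCoef_mul (h : (s : ℕ) = r + 1) (f : Equiv.Perm (Fin n) → ℝ) :
    blockProj p r s (blockCoef p r s * f) = blockCoef p r s * blockProj p r s f := by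
  ext x
  simp only [blockProj, Pi.mul_apply, blockCoef_adjSwap_left h, blockCoef_adjSwap_right h]
  ring

theorem statInner_blockProj_left (hp : IsParameterVector p) (h : (s : ℕ) = r + 1)
    (hs : ∀ x, blockCoef p r s x ≠ 1) (f g : Equiv.Perm (Fin n) → ℝ) :
    statInner p (blockProj p r s f) g = statInner p f (blockProj p r s g) := by
  have hi : ∀ F : Equiv.Perm (Fin n) → ℝ,
      coproj p r ((1 - blockCoef p r s)⁻¹ * F) = (1 - blockCoef p r s)⁻¹ * coproj p r F := fun F =>
    coproj_mul_of_invariant _ _ _ fun x => by simp [blockCoef_adjSwap_left h]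
  have hi' : ∀ F : Equiv.Perm (Fin n) → ℝ,
      coproj p s ((1 - blockCoef p r s)⁻¹ * F) = (1 - blockCoef p r s)⁻¹ * coproj p s F := fun F =>
    coproj_mul_of_invariant _ _ _ fun x => by simp [blockCoef_adjSwap_right h]
  have hi₂ : ∀ F : Equiv.Perm (Fin n) → ℝ,
      coproj p r (blockCoef p r s * F) = blockCoef p r s * coproj p r F := fun F =>
    coproj_mul_of_invariant _ _ _ fun x => by simp [blockCoef_adjSwap_left h]
  rw [blockProj_eq hp h hs, blockProj_eq hp h hs]
  simp only [statInner_mul_left, statInner_add_left, statInner_smul_left, statInner_coproj_left,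
    hi, hi', hi₂, mul_add, mul_smul_comm, statInner_add_right, statInner_smul_right]
  congr 3
  ring

/-- The decomposition as a sum of squares of the energy of two consecutive updates. -/
theorem consecutive_energy_eq (hp : IsParameterVector p) (h : (s : ℕ) = r + 1)
    (hs : ∀ x, blockCoef p r s x ≠ 1) (f : Equiv.Perm (Fin n) → ℝ) {t : ℝ} (ht : 0 < t) :
    2 * statInner p (coproj p r f) (coproj p s f) +
        (t * statInner p (coproj p r f) (coproj p r f) +
          t⁻¹ * statInner p (coproj p s f) (coproj p s f)) / 2 =
      (2 * t)⁻¹ * statInner p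
        (coproj p s f + (2 * t) • coproj p s (coproj p r f) + (-(1 + 2 * t)) • blockProj p r s f)
        (coproj p s f + (2 * t) • coproj p s (coproj p r f) + (-(1 + 2 * t)) • blockProj p r s f) +
      t / 2 * statInner p ((1 - (4 : ℝ) • blockCoef p r s) * coproj p r f) (coproj p r f) +
      (((2 * t)⁻¹ + 2) * statInner p (blockProj p r s f) (blockProj p r s f) +
        2 * t * statInner p (blockCoef p r s * blockProj p r s f) (blockProj p r s f)) := by
  -- The only nontrivial Gram entry: `‖P_s P_r f‖² = ⟨P_r f, P_r P_s P_r f⟩`, evaluated by the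
  -- triple product formula.
  have e₁ : statInner p (coproj p s (coproj p r f)) (coproj p s (coproj p r f)) =
      statInner p (blockCoef p r s * coproj p r f) (coproj p r f) +
        statInner p (blockProj p r s f) (blockProj p r s f) -
        statInner p (blockCoef p r s * blockProj p r s f) (blockProj p r s f) := by
    rw [statInner_coproj_left, coproj_coproj hp]
    nth_rw 1 [← coproj_coproj hp r f]
    rw [statInner_coproj_left, coproj_coproj_coproj hp h hs, statInner_add_right]
    have : (1 - blockCoef p r s) * blockProj p r s f =
        blockProj p r s f + (-1 : ℝ) • (blockCoef p r s * blockProj p r s f) := by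
      rw [sub_mul, one_mul]; module
    rw [this, statInner_add_right, statInner_smul_right]
    have e : statInner p (coproj p r f) (blockProj p r s f) =
        statInner p (blockProj p r s f) (blockProj p r s f) := by
      rw [statInner_coproj_left, coproj_left_blockProj hp h, statInner_blockProj_left hp h hs,
        blockProj_blockProj hp h hs]
    have e' : statInner p (coproj p r f) (blockCoef p r s * blockProj p r s f) =
        statInner p (blockCoef p r s * blockProj p r s f) (blockProj p r s f) := by
      rw [statInner_coproj_left, coproj_mul_of_invariant _ _ _ (blockCoef_adjSwap_left h),
        coproj_left_blockProj hp h, ← blockProj_blockProj hp h hs f, ← blockProj_blockCoef_mul h,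
        ← statInner_blockProj_left hp h hs, blockProj_blockProj hp h hs, statInner_comm,
        blockProj_blockCoef_mul h, blockProj_blockProj hp h hs]
    rw [e, e', statInner_comm (coproj p r f)]
    ring
  have e₂ : statInner p (coproj p s f) (coproj p s (coproj p r f)) =
      statInner p (coproj p r f) (coproj p s f) := by
    rw [← statInner_coproj_left, coproj_coproj hp, statInner_comm]
  have e₃ : statInner p (coproj p s f) (blockProj p r s f) =
      statInner p (blockProj p r s f) (blockProj p r s f) := by
    rw [statInner_coproj_left, coproj_right_blockProj hp h, statInner_blockProj_left hp h hs,
      blockProj_blockProj hp h hs]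
  have e₄ : statInner p (coproj p s (coproj p r f)) (blockProj p r s f) =
      statInner p (blockProj p r s f) (blockProj p r s f) := by
    rw [statInner_coproj_left, statInner_coproj_left, coproj_right_blockProj hp h,
      coproj_left_blockProj hp h, statInner_blockProj_left hp h hs, blockProj_blockProj hp h hs]
  have e₅ : statInner p ((1 - (4 : ℝ) • blockCoef p r s) * coproj p r f) (coproj p r f) =
      statInner p (coproj p r f) (coproj p r f) -
        4 * statInner p (blockCoef p r s * coproj p r f) (coproj p r f) := by
    have : (1 - (4 : ℝ) • blockCoef p r s) * coproj p r f =
        coproj p r f + (-4 : ℝ) • (blockCoef p r s * coproj p r f) := by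
      rw [sub_mul, one_mul, smul_mul_assoc]; module
    rw [this, statInner_add_left, statInner_smul_left]
    ring
  simp only [statInner_add_left, statInner_add_right, statInner_smul_left, statInner_smul_right]
  rw [statInner_comm (coproj p s (coproj p r f)) (coproj p s f),
    statInner_comm (blockProj p r s f) (coproj p s f),
    statInner_comm (blockProj p r s f) (coproj p s (coproj p r f)), e₁, e₂, e₃, e₄, e₅]
  field_simp
  ring

end Block

/-! ### Regularity bounds the cycle probability by 1/4. -/

section Regular

variable {n : ℕ} {p : Fin n → Fin n → ℝ}

theorem IsRegularParameterVector.le_of_le_left (hp : IsRegularParameterVector p) {i i' j : Fin n}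
    (hi : i ≤ i') (hj : i' < j) : p i' j ≤ p i j := by
  have key : ∀ (d : ℕ) (i i' : Fin n), (i' : ℕ) = i + d → i' < j → p i' j ≤ p i j := by
    intro d
    induction d with
    | zero => intro i i' h _; rw [Fin.ext (h.trans (add_zero _))]
    | succ d ih =>
      intro i i' h hj
      have hlt : (i : ℕ) + d < n := by omega
      have hj' : (⟨i + d, hlt⟩ : Fin n) < j := by
        rw [Fin.lt_def] at *; simp only; omega
      exact (hp.mono_left ⟨i + d, hlt⟩ i' j (by simp only; omega) hj).trans (ih i _ rfl hj')
  exact key (i' - i : ℕ) i i' (by rw [Fin.le_def] at hi; omega) hj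

theorem IsRegularParameterVector.le_of_le_right (hp : IsRegularParameterVector p) {i j j' : Fin n}
    (hi : i < j) (hj : j ≤ j') : p i j ≤ p i j' := by
  have key : ∀ (d : ℕ) (j' : Fin n), (j' : ℕ) = j + d → p i j ≤ p i j' := by
    intro d
    induction d with
    | zero => intro j' h; rw [Fin.ext (h.trans (add_zero _))]
    | succ d ih =>
      intro j' h
      have hlt : (j : ℕ) + d < n := by omega
      exact (ih ⟨j + d, hlt⟩ rfl).trans (hp.mono_right i _ j' (by simp only; omega)
        (by rw [Fin.lt_def] at *; simp only; omega))
  exact key (j' - j : ℕ) j' (by rw [Fin.le_def] at hj; omega)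

theorem IsRegularParameterVector.half_le_of_lt (hp : IsRegularParameterVector p) {i j : Fin n}
    (h : i < j) : 1 / 2 ≤ p i j := by
  rw [Fin.lt_def] at h
  have hlt : (i : ℕ) + 1 < n := by omega
  exact (hp.half_le i ⟨i + 1, hlt⟩ rfl).trans
    (hp.le_of_le_right (by rw [Fin.lt_def]; simp only; omega) (by rw [Fin.le_def]; simp only; omega))

theorem IsParameterVector.half_comm (hp : IsParameterVector p) {i j : Fin n} (h : i ≠ j) :
    p i j = 1 / 2 ↔ p j i = 1 / 2 := by
  have := hp.add_eq_one i j h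
  constructor <;> intro <;> linarith

theorem cycleProb_swap_left (p : Fin n → Fin n → ℝ) (a b c : Fin n) :
    cycleProb p b a c = cycleProb p a b c := by
  simp only [cycleProb]; ring

theorem cycleProb_swap_right (p : Fin n → Fin n → ℝ) (a b c : Fin n) :
    cycleProb p a c b = cycleProb p a b c := by
  simp only [cycleProb]; ring

/-- Let `m` be the larger of `p a b` and `p b c`. The coefficient `1 - p a b - p b c` of `p a c` is
nonpositive and `p a c ≥ m`, so the value is at most `m (1 - m)`. Equality with `1/4` forces `m =
1/2`, and then the smaller of the two, being at least `1/2`, equals it too. -/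
theorem IsRegularParameterVector.cycleProb_of_lt (hp : IsRegularParameterVector p) {a b c : Fin n}
    (hab : a < b) (hbc : b < c) :
    cycleProb p a b c ≤ 1 / 4 ∧
      (cycleProb p a b c = 1 / 4 → p a b = 1 / 2 ∧ p b c = 1 / 2) := by
  have h₁ := hp.half_le_of_lt hab
  have h₂ := hp.half_le_of_lt hbc
  have h₃ := hp.le_of_le_left hab.le hbc
  have h₄ := hp.le_of_le_right hab hbc.le
  have e₁ := hp.add_eq_one a b hab.ne
  have e₂ := hp.add_eq_one b c hbc.ne
  have e₃ := hp.add_eq_one a c (hab.trans hbc).ne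
  have hs : cycleProb p a b c = p a b * p b c + p a c * (1 - p a b - p b c) := by
    rw [cycleProb, show p b a = 1 - p a b by linarith, show p c b = 1 - p b c by linarith,
      show p c a = 1 - p a c by linarith]
    ring
  rcases le_total (p a b) (p b c) with h | h
  · have hle : cycleProb p a b c ≤ 1 / 4 - (p b c - 1 / 2) ^ 2 := by
      rw [hs]; nlinarith
    refine ⟨by nlinarith [sq_nonneg (p b c - 1 / 2)], fun heq => ?_⟩
    have : p b c - 1 / 2 = 0 := by
      rw [← sq_eq_zero_iff]; nlinarith [sq_nonneg (p b c - 1 / 2)]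
    constructor <;> linarith
  · have hle : cycleProb p a b c ≤ 1 / 4 - (p a b - 1 / 2) ^ 2 := by
      rw [hs]; nlinarith
    refine ⟨by nlinarith [sq_nonneg (p a b - 1 / 2)], fun heq => ?_⟩
    have : p a b - 1 / 2 = 0 := by
      rw [← sq_eq_zero_iff]; nlinarith [sq_nonneg (p a b - 1 / 2)]
    constructor <;> linarith

theorem IsRegularParameterVector.cycleProb_le (hp : IsRegularParameterVector p) {a b c : Fin n}
    (hab : a ≠ b) (hac : a ≠ c) (hbc : b ≠ c) : cycleProb p a b c ≤ 1 / 4 := by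
  rcases lt_or_gt_of_ne hab with h₁ | h₁ <;> rcases lt_or_gt_of_ne hac with h₂ | h₂ <;>
    rcases lt_or_gt_of_ne hbc with h₃ | h₃
  · exact (hp.cycleProb_of_lt h₁ h₃).1
  · rw [← cycleProb_swap_right]; exact (hp.cycleProb_of_lt h₂ h₃).1
  · exact absurd (h₁.trans h₃) h₂.not_gt
  · rw [← cycleProb_swap_right, ← cycleProb_swap_left]; exact (hp.cycleProb_of_lt h₂ h₁).1
  · rw [← cycleProb_swap_left]; exact (hp.cycleProb_of_lt h₁ h₂).1
  · exact absurd (h₁.trans h₂) h₃.not_gt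
  · rw [← cycleProb_swap_left, ← cycleProb_swap_right]; exact (hp.cycleProb_of_lt h₃ h₂).1
  · rw [← cycleProb_swap_left, ← cycleProb_swap_right, ← cycleProb_swap_left]
    exact (hp.cycleProb_of_lt h₃ h₁).1

theorem IsRegularParameterVector.blockCoef_le (hp : IsRegularParameterVector p)
    {r s : Fin (n - 1)} (h : (s : ℕ) = r + 1) (x : Equiv.Perm (Fin n)) :
    blockCoef p r s x ≤ 1 / 4 :=
  hp.cycleProb_le (fun e => leftPos_ne_rightPos r (x.injective e))
    (fun e => leftPos_ne_rightPos_succ h (x.injective e))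
    (fun e => rightPos_ne_rightPos_succ h (x.injective e))

theorem IsParameterVector.blockCoef_pos (hp : IsParameterVector p)
    {r s : Fin (n - 1)} (h : (s : ℕ) = r + 1) (x : Equiv.Perm (Fin n)) :
    0 < blockCoef p r s x := by
  have h₁ := leftPos_ne_rightPos r
  have h₂ := leftPos_ne_rightPos_succ h
  have h₃ := rightPos_ne_rightPos_succ h
  exact add_pos
    (mul_pos (mul_pos (hp.label_pos x h₁) (hp.label_pos x h₃)) (hp.label_pos x h₂.symm))
    (mul_pos (mul_pos (hp.label_pos x h₁.symm) (hp.label_pos x h₃.symm)) (hp.label_pos x h₂))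

/-- For `blockCoef ≤ 1/4` all terms of the sum of squares are nonnegative. At equality each
vanishes: the common-range part of `f`, the completed square, and `coproj p r f` wherever `1 - 4 *
blockCoef` is nonzero. -/
theorem IsRegularParameterVector.consecutive_energy_nonneg (hp : IsRegularParameterVector p)
    {r s : Fin (n - 1)} (h : (s : ℕ) = r + 1) (f : Equiv.Perm (Fin n) → ℝ) {t : ℝ} (ht : 0 < t) :
    0 ≤ 2 * statInner p (coproj p r f) (coproj p s f) +
        (t * statInner p (coproj p r f) (coproj p r f) +
          t⁻¹ * statInner p (coproj p s f) (coproj p s f)) / 2 ∧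
    (2 * statInner p (coproj p r f) (coproj p s f) +
        (t * statInner p (coproj p r f) (coproj p r f) +
          t⁻¹ * statInner p (coproj p s f) (coproj p s f)) / 2 = 0 →
      (∀ x, blockCoef p r s x ≠ 1 / 4 → coproj p r f x = 0) ∧
      ∀ x, coproj p s f x = -(2 * t) * coproj p s (coproj p r f) x) := by
  have hp' := hp.toIsParameterVector
  have hs : ∀ x, blockCoef p r s x ≠ 1 := fun x e => by linarith [hp.blockCoef_le h x]
  rw [consecutive_energy_eq hp' h hs f ht]
  set g := coproj p s f + (2 * t) • coproj p s (coproj p r f) +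
    (-(1 + 2 * t)) • blockProj p r s f with hg
  have hm : ∀ x, 0 ≤ (1 - (4 : ℝ) • blockCoef p r s) x := fun x => by
    have := hp.blockCoef_le h x
    simp only [Pi.sub_apply, Pi.one_apply, Pi.smul_apply, smul_eq_mul]
    linarith
  have n₁ := statInner_self_nonneg hp' g
  have n₂ := statInner_mul_self_nonneg hp' hm (coproj p r f)
  have n₃ := statInner_self_nonneg hp' (blockProj p r s f)
  have n₄ := statInner_mul_self_nonneg hp' (fun x => (hp'.blockCoef_pos h x).le)
    (blockProj p r s f)
  have m₁ := mul_nonneg (inv_nonneg.2 (by positivity : (0 : ℝ) ≤ 2 * t)) n₁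
  have m₂ := mul_nonneg (by positivity : 0 ≤ t / 2) n₂
  have m₃ := mul_nonneg (by positivity : 0 ≤ (2 * t)⁻¹ + 2) n₃
  have m₄ := mul_nonneg (by positivity : 0 ≤ 2 * t) n₄
  refine ⟨by linarith, fun h₀ => ?_⟩
  have z₁ : statInner p g g = 0 :=
    (mul_eq_zero.1 (by linarith : (2 * t)⁻¹ * statInner p g g = 0)).resolve_left (by positivity)
  have z₂ : statInner p ((1 - (4 : ℝ) • blockCoef p r s) * coproj p r f) (coproj p r f) = 0 :=
    (mul_eq_zero.1 (by linarith : t / 2 * _ = 0)).resolve_left (by positivity)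
  have z₃ : statInner p (blockProj p r s f) (blockProj p r s f) = 0 :=
    (mul_eq_zero.1 (by linarith : ((2 * t)⁻¹ + 2) * _ = 0)).resolve_left (by positivity)
  have z₁' := statInner_self_eq_zero hp' z₁
  have z₃' := statInner_self_eq_zero hp' z₃
  refine ⟨fun x hx => eq_zero_of_statInner_mul_self hp' hm z₂ x ?_, fun x => ?_⟩
  · simp only [Pi.sub_apply, Pi.one_apply, Pi.smul_apply, smul_eq_mul]
    intro e
    exact hx (by linarith)
  · have := congrFun z₁' x
    simp only [hg, z₃', Pi.add_apply, Pi.smul_apply, smul_eq_mul, Pi.zero_apply] at this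
    linarith

end Regular

/-! ### The spectral inequality and its equality case. -/

section Energy

variable {n : ℕ} {p : Fin n → Fin n → ℝ}

/-- The Perron eigenvector of the path with `n - 1` vertices. -/
noncomputable def pathVec {n : ℕ} (r : Fin (n - 1)) : ℝ := Real.sin (((r : ℕ) + 1) * (Real.pi / n))

/-- The adjacency matrix of the path with `n - 1` vertices. -/
noncomputable def pathAdj {n : ℕ} (r s : Fin (n - 1)) : ℝ :=
  if (s : ℕ) = r + 1 ∨ (r : ℕ) = s + 1 then 1 else 0

theorem pathVec_pos (r : Fin (n - 1)) : 0 < pathVec r := by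
  have hr := r.2
  have hn : (0 : ℝ) < n := by exact_mod_cast (by omega : 0 < n)
  have h : ((r : ℕ) : ℝ) + 1 < n := by exact_mod_cast (by omega : (r : ℕ) + 1 < n)
  apply Real.sin_pos_of_pos_of_lt_pi
  · have := Real.pi_pos; positivity
  · rw [mul_div_assoc', div_lt_iff₀ hn, mul_comm]
    exact mul_lt_mul_of_pos_left h Real.pi_pos

theorem sum_fin_ite_val_eq {m : ℕ} (k : ℕ) (g : ℕ → ℝ) :
    ∑ s : Fin m, (if (s : ℕ) = k then g s else 0) = if k < m then g k else 0 := by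
  rw [Fin.sum_univ_eq_sum_range (fun i => if i = k then g i else 0) m, Finset.sum_ite_eq']
  simp

/-- Addition formulas for the sine; the missing neighbours of the two end vertices would contribute
`sin 0` and `sin π`, hence nothing. -/
theorem sum_pathAdj_mul_pathVec (r : Fin (n - 1)) :
    ∑ s, pathAdj r s * pathVec s = 2 * Real.cos (Real.pi / n) * pathVec r := by
  have hr := r.2
  have hn : (n : ℝ) ≠ 0 := by exact_mod_cast (by omega : n ≠ 0)
  have hsplit : ∀ s : Fin (n - 1), pathAdj r s * pathVec s =
      (if (s : ℕ) = r + 1 then Real.sin (((s : ℕ) + 1) * (Real.pi / n)) else 0) +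
      (if (r : ℕ) = s + 1 then Real.sin (((s : ℕ) + 1) * (Real.pi / n)) else 0) := by
    intro s
    simp only [pathAdj, pathVec]
    by_cases h₁ : (s : ℕ) = r + 1
    · have h₂ : ¬ (r : ℕ) = s + 1 := by omega
      rw [if_pos (Or.inl h₁), if_pos h₁, if_neg h₂, one_mul, add_zero]
    · simp [h₁]
  simp only [hsplit, sum_add_distrib]
  have h₁ : ∑ s : Fin (n - 1),
      (if (s : ℕ) = r + 1 then Real.sin (((s : ℕ) + 1) * (Real.pi / n)) else 0) =
      Real.sin (((r : ℕ) + 1) * (Real.pi / n) + Real.pi / n) := by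
    rw [sum_fin_ite_val_eq (r + 1) fun k => Real.sin (((k : ℕ) + 1) * (Real.pi / n))]
    have e : (((r : ℕ) + 1 : ℕ) + 1 : ℝ) * (Real.pi / n) =
      ((r : ℕ) + 1) * (Real.pi / n) + Real.pi / n := by push_cast; ring
    split_ifs with h
    · rw [e]
    · have : (((r : ℕ) + 1 : ℕ) + 1 : ℝ) = n := by exact_mod_cast (by omega : (r : ℕ) + 1 + 1 = n)
      rw [← e, this, mul_div_cancel₀ _ hn, Real.sin_pi]
  have h₂ : ∑ s : Fin (n - 1),
      (if (r : ℕ) = s + 1 then Real.sin (((s : ℕ) + 1) * (Real.pi / n)) else 0) =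
      Real.sin (((r : ℕ) + 1) * (Real.pi / n) - Real.pi / n) := by
    rcases Nat.eq_zero_or_pos (r : ℕ) with h | h
    · simp [h]
    · have hk : ∀ s : Fin (n - 1), ((r : ℕ) = s + 1) = ((s : ℕ) = r - 1) := fun s => by
        apply propext; omega
      simp only [hk]
      rw [sum_fin_ite_val_eq (r - 1) fun k => Real.sin (((k : ℕ) + 1) * (Real.pi / n)),
        if_pos (by omega), Nat.cast_sub h]
      congr 1
      push_cast
      ring
  rw [h₁, h₂, Real.sin_add, Real.sin_sub, pathVec]
  ring

/-- The contribution of the pair `(r, s)` to the energy estimate. -/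
noncomputable def pairEnergy (p : Fin n → Fin n → ℝ) (f : Equiv.Perm (Fin n) → ℝ)
    (r s : Fin (n - 1)) : ℝ :=
  statInner p (coproj p r f) (coproj p s f) -
      (if r = s then statInner p (coproj p r f) (coproj p r f) else 0) +
    pathAdj r s * (pathVec s / pathVec r * statInner p (coproj p r f) (coproj p r f) +
      pathVec r / pathVec s * statInner p (coproj p s f) (coproj p s f)) / 4

theorem pathAdj_comm (r s : Fin (n - 1)) : pathAdj r s = pathAdj s r := by
  simp only [pathAdj, or_comm]

theorem pairEnergy_comm (f : Equiv.Perm (Fin n) → ℝ) (r s : Fin (n - 1)) :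
    pairEnergy p f r s = pairEnergy p f s r := by
  simp only [pairEnergy, pathAdj_comm r s, statInner_comm (coproj p r f) (coproj p s f)]
  by_cases h : r = s
  · subst h; ring
  · simp only [h, Ne.symm h, if_false]; ring

/-- Commuting orthogonal projections satisfy `⟨P_r f, P_s f⟩ = ‖P_r P_s f‖²`. -/
theorem pairEnergy_of_farApart {r s : Fin (n - 1)} (h : FarApart r s)
    (hp : IsParameterVector p) (f : Equiv.Perm (Fin n) → ℝ) :
    pairEnergy p f r s =
      statInner p (coproj p r (coproj p s f)) (coproj p r (coproj p s f)) := by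
  have h₁ : r ≠ s := by rintro rfl; rcases h with h | h <;> omega
  have h₂ : ¬ ((s : ℕ) = r + 1 ∨ (r : ℕ) = s + 1) := by rcases h with h | h <;> omega
  have h₃ : statInner p (coproj p r (coproj p s f)) (coproj p r (coproj p s f)) =
      statInner p (coproj p r f) (coproj p s f) := by
    rw [statInner_coproj_left, coproj_coproj hp, coproj_comm h, statInner_comm,
      statInner_coproj_left, coproj_coproj hp]
  rw [pairEnergy, pathAdj, if_neg h₁, if_neg h₂, h₃]
  ring

/-- This is the consecutive energy with `t = pathVec s / pathVec r`, halved because the double sum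
contains the pair in both orders. -/
theorem pairEnergy_of_succ {r s : Fin (n - 1)} (h : (s : ℕ) = r + 1)
    (f : Equiv.Perm (Fin n) → ℝ) :
    pairEnergy p f r s = (2 * statInner p (coproj p r f) (coproj p s f) +
        (pathVec s / pathVec r * statInner p (coproj p r f) (coproj p r f) +
          (pathVec s / pathVec r)⁻¹ * statInner p (coproj p s f) (coproj p s f)) / 2) / 2 := by
  have h₁ : r ≠ s := by rintro rfl; omega
  rw [pairEnergy, pathAdj, if_neg h₁, if_pos (Or.inl h), inv_div]
  ring

theorem farApart_or (r s : Fin (n - 1)) :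
    r = s ∨ FarApart r s ∨ (s : ℕ) = r + 1 ∨ (r : ℕ) = s + 1 := by
  unfold FarApart
  rw [Fin.ext_iff]
  omega

theorem pairEnergy_nonneg (hp : IsRegularParameterVector p) (f : Equiv.Perm (Fin n) → ℝ)
    (r s : Fin (n - 1)) : 0 ≤ pairEnergy p f r s := by
  have key : ∀ r s : Fin (n - 1), (s : ℕ) = r + 1 → 0 ≤ pairEnergy p f r s := fun r s h => by
    rw [pairEnergy_of_succ h]
    exact div_nonneg (hp.consecutive_energy_nonneg h f
      (div_pos (pathVec_pos s) (pathVec_pos r))).1 zero_le_two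
  rcases farApart_or r s with rfl | h | h | h
  · have : pathAdj r r = 0 := if_neg (by omega)
    simp [pairEnergy, this]
  · rw [pairEnergy_of_farApart h hp.toIsParameterVector]
    exact statInner_self_nonneg hp.toIsParameterVector _
  · exact key r s h
  · rw [pairEnergy_comm]; exact key s r h

theorem statInner_sum_coproj (hp : IsParameterVector p) (f : Equiv.Perm (Fin n) → ℝ) :
    statInner p (∑ r, coproj p r f) f = ∑ r, statInner p (coproj p r f) (coproj p r f) := by
  rw [statInner_sum_left]
  refine Finset.sum_congr rfl fun r _ => ?_
  conv_lhs => rw [← coproj_coproj hp]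
  rw [statInner_coproj_left]

/-- By the Perron equation each of the two weighted sums is `2 cos (π / n) ∑ ‖P_r f‖²`; the factor
`1/4` turns their total into `cos (π / n) ∑ ‖P_r f‖²`. -/
theorem sum_pairEnergy (hp : IsParameterVector p) (f : Equiv.Perm (Fin n) → ℝ) :
    ∑ r, ∑ s, pairEnergy p f r s =
      statInner p (∑ r, coproj p r f) (∑ r, coproj p r f) -
        (1 - Real.cos (Real.pi / n)) * statInner p (∑ r, coproj p r f) f := by
  have h₁ : ∑ r : Fin (n - 1), ∑ s : Fin (n - 1),
      pathAdj r s * (pathVec s / pathVec r * statInner p (coproj p r f) (coproj p r f)) =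
      2 * Real.cos (Real.pi / n) * ∑ r, statInner p (coproj p r f) (coproj p r f) := by
    rw [mul_sum]
    refine Finset.sum_congr rfl fun r _ => ?_
    have := sum_pathAdj_mul_pathVec r
    have hr := (pathVec_pos r).ne'
    calc _ = (∑ s, pathAdj r s * pathVec s) / pathVec r *
          statInner p (coproj p r f) (coproj p r f) := by
          rw [sum_div, sum_mul]
          exact Finset.sum_congr rfl fun s _ => by ring
      _ = _ := by rw [this]; field_simp
  have h₂ : ∑ r : Fin (n - 1), ∑ s : Fin (n - 1),
      pathAdj r s * (pathVec r / pathVec s * statInner p (coproj p s f) (coproj p s f)) =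
      2 * Real.cos (Real.pi / n) * ∑ r, statInner p (coproj p r f) (coproj p r f) := by
    rw [Finset.sum_comm, ← h₁]
    simp only [pathAdj_comm]
  rw [statInner_sum_coproj hp, statInner_sum_left]
  simp only [statInner_sum_right, pairEnergy, sum_add_distrib, sum_sub_distrib, ← sum_div,
    mul_add, h₁, h₂, sum_ite_eq, mem_univ, if_true]
  ring

theorem spectral_inequality (hp : IsRegularParameterVector p) (f : Equiv.Perm (Fin n) → ℝ) :
    (1 - Real.cos (Real.pi / n)) * statInner p (∑ r, coproj p r f) f ≤
      statInner p (∑ r, coproj p r f) (∑ r, coproj p r f) := by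
  have := sum_pairEnergy hp.toIsParameterVector f
  have h : 0 ≤ ∑ r, ∑ s, pairEnergy p f r s :=
    Finset.sum_nonneg fun r _ => Finset.sum_nonneg fun s _ => pairEnergy_nonneg hp f r s
  linarith

/-- The relations that characterize equality in the energy estimate. -/
structure IsTight (p : Fin n → Fin n → ℝ) (f : Equiv.Perm (Fin n) → ℝ) : Prop where
  far : ∀ r s x, FarApart r s → diffAt r f (adjSwap x s) = diffAt r f x
  vanish : ∀ (r s : Fin (n - 1)) x, (s : ℕ) = r + 1 → blockCoef p r s x ≠ 1 / 4 →
    diffAt r f x = 0 ∧ diffAt s f x = 0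
  relation : ∀ (r s : Fin (n - 1)) x, (s : ℕ) = r + 1 →
    pathVec r * diffAt s f x = 2 * pathVec s *
      (p (x (rightPos s)) (x (leftPos r)) * diffAt r f (adjSwap x s) -
        p (x (rightPos r)) (x (leftPos r)) * diffAt r f x)

/-- For such `f` the nonnegative pair energies sum to zero, so equality holds in every pair
estimate. -/
theorem isTight_of_eigenfunction (hp : IsRegularParameterVector p) {f : Equiv.Perm (Fin n) → ℝ}
    (hf : ∑ r, coproj p r f = (1 - Real.cos (Real.pi / n)) • f) : IsTight p f := by
  have hp' := hp.toIsParameterVector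
  have hzero : ∀ r s, pairEnergy p f r s = 0 := by
    have h := sum_pairEnergy hp' f
    rw [hf] at h
    simp only [statInner_smul_left, statInner_smul_right] at h
    rw [sub_self] at h
    intro r s
    have h₁ := (Finset.sum_eq_zero_iff_of_nonneg fun r _ =>
      Finset.sum_nonneg fun s _ => pairEnergy_nonneg hp f r s).1 h r (mem_univ r)
    exact (Finset.sum_eq_zero_iff_of_nonneg fun s _ => pairEnergy_nonneg hp f r s).1 h₁ s
      (mem_univ s)
  have hsucc : ∀ r s : Fin (n - 1), (s : ℕ) = r + 1 →
      (∀ x, blockCoef p r s x ≠ 1 / 4 → diffAt r f x = 0) ∧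
      ∀ x, diffAt s f x = -(2 * (pathVec s / pathVec r)) * diffAt s (coproj p r f) x := by
    intro r s h
    have h₀ := hzero r s
    rw [pairEnergy_of_succ h] at h₀
    obtain ⟨h₁, h₂⟩ := (hp.consecutive_energy_nonneg h f
      (div_pos (pathVec_pos s) (pathVec_pos r))).2 (by linarith)
    refine ⟨fun x hx => ?_, fun x => ?_⟩
    · exact (mul_eq_zero.1 (h₁ x hx)).resolve_left
        (hp'.label_pos x (leftPos_ne_rightPos r).symm).ne'
    · have h₃ := h₂ x
      have hpos := hp'.label_pos x (leftPos_ne_rightPos s).symm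
      simp only [coproj] at h₃
      refine mul_left_cancel₀ hpos.ne' (h₃.trans ?_)
      unfold coproj
      ring
  refine ⟨fun r s x h => ?_, fun r s x h hx => ?_, fun r s x h => ?_⟩
  · have h₀ := hzero s r
    rw [pairEnergy_of_farApart h.symm hp'] at h₀
    have h₁ := congrFun (statInner_self_eq_zero hp' h₀) x
    have hs := (mul_eq_zero.1 h₁).resolve_left
      (hp'.label_pos x (leftPos_ne_rightPos s).symm).ne'
    simp only [diffAt, coproj, h.adjSwap_leftPos, h.adjSwap_rightPos, ← mul_sub] at hs
    have := (mul_eq_zero.1 hs).resolve_left (hp'.label_pos x (leftPos_ne_rightPos r).symm).ne'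
    simp only [diffAt]
    linarith
  · have h₁ := (hsucc r s h).1 x hx
    -- The swap `s` preserves the coefficient, so both values of `coproj p r f` that determine
    -- `diffAt s f x` vanish.
    have h₂ := (hsucc r s h).1 (adjSwap x s) (by rwa [blockCoef_adjSwap_right h])
    refine ⟨h₁, ?_⟩
    rw [(hsucc r s h).2 x, diffAt, coproj, coproj, h₁, h₂]
    ring
  · rw [(hsucc r s h).2 x, diffAt, coproj, coproj, adjSwap_succ_leftPos h, adjSwap_succ_middle h]
    have := (pathVec_pos r).ne'
    field_simp
    ring

end Energy

/-! ### Functions of the first few labels. -/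

section Rearrangement

variable {n : ℕ}

theorem exists_move_to_front {g : Equiv.Perm (Fin n) → ℝ} {m : ℕ}
    (hg : ∀ (s : Fin (n - 1)) x, m ≤ (s : ℕ) → g (adjSwap x s) = g x) {k : ℕ} (hmk : m ≤ k)
    (hk : k < n) (x : Equiv.Perm (Fin n)) :
    ∃ y : Equiv.Perm (Fin n), g y = g x ∧ (∀ i : Fin n, (i : ℕ) < m → y i = x i) ∧
      y ⟨m, hmk.trans_lt hk⟩ = x ⟨k, hk⟩ := by
  induction k, hmk using Nat.le_induction generalizing x with
  | base => exact ⟨x, rfl, fun _ _ => rfl, rfl⟩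
  | succ k hmk ih =>
    let s : Fin (n - 1) := ⟨k, by omega⟩
    obtain ⟨y, h₁, h₂, h₃⟩ := ih (by omega) (adjSwap x s)
    refine ⟨y, h₁.trans (hg s x hmk), fun i hi => ?_, h₃.trans (adjSwap_leftPos x s)⟩
    rw [h₂ i hi, adjSwap_of_ne] <;> simp only [s] <;> omega

/-- Swaps at positions from `m` on leave `g` unchanged and generate all rearrangements of the tail:
bubble the labels of `x` into place one at a time. -/
theorem eq_of_agree {g : Equiv.Perm (Fin n) → ℝ} {m : ℕ}
    (hg : ∀ (s : Fin (n - 1)) x, m ≤ (s : ℕ) → g (adjSwap x s) = g x)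
    {x y : Equiv.Perm (Fin n)} (h : ∀ i : Fin n, (i : ℕ) < m → x i = y i) : g x = g y := by
  induction hd : n - m generalizing m y with
  | zero =>
    have : x = y := Equiv.ext fun i => h i (by omega)
    rw [this]
  | succ d ih =>
    have hm : m < n := by omega
    have hk : m ≤ (y.symm (x ⟨m, hm⟩) : ℕ) := by
      by_contra hlt
      have := h _ (not_le.1 hlt)
      rw [Equiv.apply_symm_apply] at this
      have := congrArg Fin.val (x.injective this)
      simp only at this
      omega
    obtain ⟨z, h₁, h₂, h₃⟩ := exists_move_to_front hg hk (y.symm (x ⟨m, hm⟩)).2 y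
    rw [← h₁]
    refine ih (m := m + 1) (fun s x hs => hg s x (by omega)) (fun i hi => ?_) (by omega)
    rcases Nat.lt_succ_iff_lt_or_eq.1 hi with hi | hi
    · rw [h i hi, h₂ i hi]
    · obtain rfl : i = ⟨m, hm⟩ := Fin.ext hi
      rw [h₃, Fin.eta, Equiv.apply_symm_apply]

theorem exists_perm_apply_eq {i j a b : Fin n} (hij : i ≠ j) (hab : a ≠ b) :
    ∃ x : Equiv.Perm (Fin n), x i = a ∧ x j = b := by
  refine ⟨Equiv.swap (Equiv.swap i a j) b * Equiv.swap i a, ?_, ?_⟩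
  · rw [Equiv.Perm.mul_apply, Equiv.swap_apply_left, Equiv.swap_apply_of_ne_of_ne _ hab]
    intro h
    exact hij ((Equiv.swap i a).injective ((Equiv.swap_apply_left i a).trans h))
  · rw [Equiv.Perm.mul_apply, Equiv.swap_apply_left]

end Rearrangement

/-! ### Propagation of the changes of a tight function along the positions. -/

section Tight

variable {n : ℕ} {p : Fin n → Fin n → ℝ} {f : Equiv.Perm (Fin n) → ℝ}

/-- For labels `a, b, c` the three arrangements show `(a, b)`, `(b, c)`, `(c, a)` at `r`. Going
round the braid hexagon equates the sums of `r`-changes and `s`-changes, whereas the three tight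
relations make the latter a negative multiple of the former; so both are zero. -/
theorem IsTight.cyclic_relations (hf : IsTight p f) {r s : Fin (n - 1)} (h : (s : ℕ) = r + 1)
    (hp : IsParameterVector p) (x : Equiv.Perm (Fin n)) :
    diffAt r f x + diffAt r f (adjSwap (adjSwap x r) s) + diffAt r f (adjSwap (adjSwap x s) r) = 0 ∧
    pathVec r * diffAt s f (adjSwap (adjSwap x s) r) = -(2 * pathVec s) *
      (p (x (rightPos r)) (x (rightPos s)) * diffAt r f (adjSwap (adjSwap x r) s) +
        p (x (leftPos r)) (x (rightPos s)) * diffAt r f (adjSwap (adjSwap x s) r)) := by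
  have e₁ := hf.relation r s x h
  have e₂ := hf.relation r s (adjSwap (adjSwap x r) s) h
  have e₃ := hf.relation r s (adjSwap (adjSwap x s) r) h
  simp only [adjSwap_leftPos, adjSwap_rightPos, adjSwap_succ_leftPos h, adjSwap_succ_middle h,
    adjSwap_succ_right h, adjSwap_pred_rightPos h, adjSwap_adjSwap, adjSwap_braid h,
    diffAt_adjSwap] at e₁ e₂ e₃
  have e₄ : diffAt r f (adjSwap x s) = -diffAt r f (adjSwap (adjSwap x s) r) := by
    rw [diffAt_adjSwap, neg_neg]
  have hex : diffAt r f x + diffAt r f (adjSwap (adjSwap x r) s) +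
      diffAt r f (adjSwap (adjSwap x s) r) =
      diffAt s f x + diffAt s f (adjSwap (adjSwap x r) s) +
        diffAt s f (adjSwap (adjSwap x s) r) := by
    simp only [diffAt, adjSwap_adjSwap, adjSwap_braid h]
    ring
  have e₅ : diffAt s f (adjSwap x r) = -diffAt s f (adjSwap (adjSwap x r) s) := by
    rw [diffAt_adjSwap, neg_neg]
  simp only [e₅, neg_neg] at e₂
  simp only [e₄, neg_neg] at e₁ e₃
  rw [hp.add_eq_one_apply x (leftPos_ne_rightPos r)] at e₂
  rw [hp.add_eq_one_apply x (leftPos_ne_rightPos_succ h)] at e₃ ⊢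
  rw [hp.add_eq_one_apply x (rightPos_ne_rightPos_succ h)] at e₃ ⊢
  have hr := pathVec_pos r
  have hs := pathVec_pos s
  refine ⟨?_, by linear_combination e₃⟩
  have : (pathVec r + 2 * pathVec s) * (diffAt r f x + diffAt r f (adjSwap (adjSwap x r) s) +
      diffAt r f (adjSwap (adjSwap x s) r)) = 0 := by
    linear_combination pathVec r * hex + e₁ + e₂ + e₃
  exact (mul_eq_zero.1 this).resolve_left (by positivity)

/-- With weights `1/2` the second cyclic relation involves only the sum of two changes, which the
first replaces by minus the third. The change of one pair of labels thus moves one position to the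
right. -/
theorem IsTight.shift (hf : IsTight p f) {r s : Fin (n - 1)} (h : (s : ℕ) = r + 1)
    (hp : IsParameterVector p) (x : Equiv.Perm (Fin n))
    (h₁ : p (x (rightPos r)) (x (rightPos s)) = 1 / 2 ∨ diffAt r f (adjSwap (adjSwap x r) s) = 0)
    (h₂ : p (x (leftPos r)) (x (rightPos s)) = 1 / 2 ∨ diffAt r f (adjSwap (adjSwap x s) r) = 0) :
    pathVec r * diffAt s f (adjSwap (adjSwap x s) r) = pathVec s * diffAt r f x := by
  obtain ⟨e₁, e₂⟩ := hf.cyclic_relations h hp x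
  have k₁ : p (x (rightPos r)) (x (rightPos s)) * diffAt r f (adjSwap (adjSwap x r) s) =
      1 / 2 * diffAt r f (adjSwap (adjSwap x r) s) := by
    rcases h₁ with h₁ | h₁ <;> simp [h₁]
  have k₂ : p (x (leftPos r)) (x (rightPos s)) * diffAt r f (adjSwap (adjSwap x s) r) =
      1 / 2 * diffAt r f (adjSwap (adjSwap x s) r) := by
    rcases h₂ with h₂ | h₂ <;> simp [h₂]
  rw [e₂, k₁, k₂]
  linear_combination -pathVec s * e₁

theorem IsNeutral.half_left {c i : Fin n} (h : IsNeutral p c) (hi : i ≠ c) : p c i = 1 / 2 :=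
  (h i hi).1

theorem IsNeutral.half_right {c i : Fin n} (h : IsNeutral p c) (hi : i ≠ c) : p i c = 1 / 2 :=
  (h i hi).2

/-- The function `f` does not change when two adjacent labels outside `J` at the positions `r`
and `r + 1` are exchanged. -/
def VanishesOutside (J : Set (Fin n)) (f : Equiv.Perm (Fin n) → ℝ) (r : Fin (n - 1)) : Prop :=
  ∀ x : Equiv.Perm (Fin n), x (leftPos r) ∉ J → x (rightPos r) ∉ J → diffAt r f x = 0

variable {J : Set (Fin n)}

/-- Each pair with the third label either contains a neutral label, giving weight `1/2`, or avoids
`J`, giving zero change. -/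
theorem IsTight.shift_of_vanishesOutside (hf : IsTight p f) (hp : IsParameterVector p)
    (hJ : ∀ c ∈ J, IsNeutral p c) {r s : Fin (n - 1)} (h : (s : ℕ) = r + 1)
    (hv : VanishesOutside J f r) (x : Equiv.Perm (Fin n)) :
    pathVec r * diffAt s f (adjSwap (adjSwap x s) r) = pathVec s * diffAt r f x := by
  have hne₁ : x (rightPos r) ≠ x (rightPos s) := fun e =>
    rightPos_ne_rightPos_succ h (x.injective e)
  have hne₂ : x (leftPos r) ≠ x (rightPos s) := fun e =>
    leftPos_ne_rightPos_succ h (x.injective e)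
  apply hf.shift h hp
  · by_cases h₁ : x (rightPos r) ∈ J
    · exact Or.inl ((hJ _ h₁).half_left hne₁.symm)
    by_cases h₂ : x (rightPos s) ∈ J
    · exact Or.inl ((hJ _ h₂).half_right hne₁)
    refine Or.inr (hv _ ?_ ?_)
    · rwa [adjSwap_succ_leftPos h, adjSwap_leftPos]
    · rwa [adjSwap_succ_middle h, adjSwap_pred_rightPos h]
  · by_cases h₁ : x (leftPos r) ∈ J
    · exact Or.inl ((hJ _ h₁).half_left hne₂.symm)
    by_cases h₂ : x (rightPos s) ∈ J
    · exact Or.inl ((hJ _ h₂).half_right hne₂)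
    refine Or.inr (hv _ ?_ ?_)
    · rwa [adjSwap_leftPos, adjSwap_succ_middle h]
    · rwa [adjSwap_rightPos, adjSwap_succ_leftPos h]

theorem IsTight.vanishesOutside_succ (hf : IsTight p f) (hp : IsParameterVector p)
    (hJ : ∀ c ∈ J, IsNeutral p c) {r s : Fin (n - 1)} (h : (s : ℕ) = r + 1)
    (hv : VanishesOutside J f r) : VanishesOutside J f s := by
  intro y h₁ h₂
  have e := hf.shift_of_vanishesOutside hp hJ h hv (adjSwap (adjSwap y r) s)
  rw [adjSwap_adjSwap, adjSwap_adjSwap, hv _ ?_ ?_, mul_zero] at e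
  · exact (mul_eq_zero.1 e).resolve_left (pathVec_pos r).ne'
  · rw [adjSwap_succ_leftPos h, adjSwap_leftPos, ← leftPos_of_succ h]
    exact h₁
  · rw [adjSwap_succ_middle h, adjSwap_pred_rightPos h]
    exact h₂

/-- All swaps beyond the first two positions are far from `r₀`. At an inner position swaps on the
left side would be needed too, hence the start at the first one. -/
theorem IsTight.diffAt_zero_eq (hf : IsTight p f) {r₀ : Fin (n - 1)} (hr₀ : (r₀ : ℕ) = 0)
    {x y : Equiv.Perm (Fin n)} (h₁ : x (leftPos r₀) = y (leftPos r₀))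
    (h₂ : x (rightPos r₀) = y (rightPos r₀)) : diffAt r₀ f x = diffAt r₀ f y := by
  refine eq_of_agree (m := 2) (fun s z hs => hf.far r₀ s z (Or.inl (by omega))) fun i hi => ?_
  rcases (by omega : (i : ℕ) = 0 ∨ (i : ℕ) = 1) with h | h
  · obtain rfl : i = leftPos r₀ := Fin.ext (by simp [leftPos, h, hr₀])
    exact h₁
  · obtain rfl : i = rightPos r₀ := Fin.ext (by simp [rightPos, h, hr₀])
    exact h₂

theorem IsTight.diffAt_eq (hf : IsTight p f) (hp : IsParameterVector p)
    (hJ : ∀ c ∈ J, IsNeutral p c) {r₀ : Fin (n - 1)} (hr₀ : (r₀ : ℕ) = 0)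
    (hv : VanishesOutside J f r₀) (r : Fin (n - 1)) :
    VanishesOutside J f r ∧ ∀ x y : Equiv.Perm (Fin n), x (leftPos r₀) = y (leftPos r) →
      x (rightPos r₀) = y (rightPos r) →
      pathVec r₀ * diffAt r f y = pathVec r * diffAt r₀ f x := by
  obtain ⟨k, hk⟩ := r
  induction k with
  | zero =>
    obtain rfl : r₀ = ⟨0, hk⟩ := Fin.ext hr₀
    exact ⟨hv, fun x y h₁ h₂ => by rw [hf.diffAt_zero_eq rfl h₁ h₂]⟩
  | succ k ih =>
    have hk' : k < n - 1 := by omega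
    obtain ⟨ih₁, ih₂⟩ := ih hk'
    have h : ((⟨k + 1, hk⟩ : Fin (n - 1)) : ℕ) = (⟨k, hk'⟩ : Fin (n - 1)) + 1 := rfl
    refine ⟨hf.vanishesOutside_succ hp hJ h ih₁, fun x y h₁ h₂ => ?_⟩
    have e := hf.shift_of_vanishesOutside hp hJ h ih₁ (adjSwap (adjSwap y ⟨k, hk'⟩) ⟨k + 1, hk⟩)
    rw [adjSwap_adjSwap, adjSwap_adjSwap] at e
    have e' := ih₂ x (adjSwap (adjSwap y ⟨k, hk'⟩) ⟨k + 1, hk⟩)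
      (by rw [adjSwap_succ_leftPos h, adjSwap_leftPos, ← leftPos_of_succ h, h₁])
      (by rw [adjSwap_succ_middle h, adjSwap_pred_rightPos h, h₂])
    refine mul_left_cancel₀ (pathVec_pos ⟨k, hk'⟩).ne' ?_
    linear_combination pathVec r₀ * e + pathVec ⟨k + 1, hk⟩ * e'

theorem exists_third_label {r s : Fin (n - 1)} (hr : (r : ℕ) = 0) (h : (s : ℕ) = r + 1)
    (hf : IsTight p f) (x : Equiv.Perm (Fin n)) {c : Fin n} (h₁ : c ≠ x (leftPos r))
    (h₂ : c ≠ x (rightPos r)) :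
    ∃ y : Equiv.Perm (Fin n), diffAt r f y = diffAt r f x ∧ y (leftPos r) = x (leftPos r) ∧
      y (rightPos r) = x (rightPos r) ∧ y (rightPos s) = c := by
  have hk : 2 ≤ (x.symm c : ℕ) := by
    by_contra hlt
    rcases (by omega : (x.symm c : ℕ) = 0 ∨ (x.symm c : ℕ) = 1) with h | h
    · apply h₁
      rw [← Equiv.symm_apply_eq]
      exact Fin.ext (by simp [leftPos, h, hr])
    · apply h₂
      rw [← Equiv.symm_apply_eq]
      exact Fin.ext (by simp [rightPos, h, hr])
  obtain ⟨y, e₁, e₂, e₃⟩ := exists_move_to_front (g := diffAt r f) (m := 2)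
    (fun s z hs => hf.far r s z (Or.inl (by omega))) hk (x.symm c).2 x
  refine ⟨y, e₁, e₂ _ (by simp [leftPos, hr]), e₂ _ (by simp [rightPos, hr]), ?_⟩
  rw [Fin.eta, Equiv.apply_symm_apply] at e₃
  rw [← e₃]
  congr 1
  exact Fin.ext (by simp [rightPos, h, hr])

end Tight

/-! ### Reconstruction of a tight function from its changes. -/

section PositionFunctions

variable {n : ℕ} {p : Fin n → Fin n → ℝ} {f : Equiv.Perm (Fin n) → ℝ}

/-- The second eigenvector of the random walk of a single label on the positions. -/
noncomputable def posVec {n : ℕ} (k : Fin n) : ℝ := Real.cos (((k : ℕ) + 1 / 2) * (Real.pi / n))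

/-- The Perron vector is, up to scale, the discrete derivative of `posVec`; hence changes
proportional to `pathVec` integrate to functions of label positions. -/
theorem posVec_sub (r : Fin (n - 1)) :
    posVec (leftPos r) - posVec (rightPos r) = 2 * Real.sin (Real.pi / n / 2) * pathVec r := by
  rw [posVec, posVec, pathVec, val_leftPos, val_rightPos]
  have e₁ : (((r : ℕ) : ℝ) + 1 / 2) * (Real.pi / n) =
    (((r : ℕ) : ℝ) + 1) * (Real.pi / n) - Real.pi / n / 2 := by ring
  have e₂ : (((r : ℕ) + 1 : ℕ) + 1 / 2 : ℝ) * (Real.pi / n) =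
    (((r : ℕ) : ℝ) + 1) * (Real.pi / n) + Real.pi / n / 2 := by push_cast; ring
  rw [e₁, e₂, Real.cos_sub, Real.cos_add]
  ring

theorem sin_half_pos (hn : 2 ≤ n) : 0 < Real.sin (Real.pi / n / 2) := by
  have hn' : (2 : ℝ) ≤ n := by exact_mod_cast hn
  have := Real.pi_pos
  apply Real.sin_pos_of_pos_of_lt_pi (by positivity)
  have : Real.pi / n ≤ Real.pi := div_le_self this.le (by linarith)
  linarith

/-- The linear combination with coefficients `w` of the functions `posVec` of the positions of the
labels. -/
noncomputable def labelSum : (Fin n → ℝ) →ₗ[ℝ] (Equiv.Perm (Fin n) → ℝ) where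
  toFun w x := ∑ k, posVec k * w (x k)
  map_add' w w' := by ext x; simp [mul_add, sum_add_distrib]
  map_smul' c w := by
    ext x
    simp only [Pi.smul_apply, smul_eq_mul, RingHom.id_apply, mul_sum]
    exact Finset.sum_congr rfl fun k _ => by ring

theorem labelSum_apply (w : Fin n → ℝ) (x : Equiv.Perm (Fin n)) :
    labelSum w x = ∑ k, posVec k * w (x k) := rfl

theorem labelSum_adjSwap (w : Fin n → ℝ) (r : Fin (n - 1)) (x : Equiv.Perm (Fin n)) :
    labelSum w (adjSwap x r) =
      ∑ k, posVec (Equiv.swap (leftPos r) (rightPos r) k) * w (x k) := by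
  rw [labelSum_apply]
  refine Fintype.sum_equiv (Equiv.swap (leftPos r) (rightPos r)) _ _ fun k => ?_
  rw [adjSwap_apply, Equiv.swap_apply_self]

theorem diffAt_labelSum (w : Fin n → ℝ) (r : Fin (n - 1)) (x : Equiv.Perm (Fin n)) :
    diffAt r (labelSum w) x =
      (posVec (leftPos r) - posVec (rightPos r)) * (w (x (leftPos r)) - w (x (rightPos r))) := by
  rw [diffAt, labelSum_adjSwap, labelSum_apply, ← sum_sub_distrib]
  rw [← Finset.sum_subset (subset_univ {leftPos r, rightPos r}),
    Finset.sum_pair (leftPos_ne_rightPos r), Equiv.swap_apply_left, Equiv.swap_apply_right]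
  · ring
  · intro k _ hk
    simp only [mem_insert, mem_singleton, not_or] at hk
    rw [Equiv.swap_apply_of_ne_of_ne hk.1 hk.2, sub_self]

/-- The first change is antisymmetric in its two labels and sums to zero around three labels, so it
is a coboundary `v a - v b`. Taking `v a` to be the change for `(a, d)` with `d ∉ J` makes `v`
vanish off `J`. -/
theorem IsTight.exists_labelSum (hf : IsTight p f) (hn : 3 ≤ n) (hp : IsParameterVector p)
    {J : Set (Fin n)} (hJ : ∀ c ∈ J, IsNeutral p c) {d : Fin n} (hd : d ∉ J)
    {r₀ : Fin (n - 1)} (hr₀ : (r₀ : ℕ) = 0) (hv : VanishesOutside J f r₀) :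
    ∃ w : Fin n → ℝ, (∀ c ∉ J, w c = 0) ∧ ∀ r x, diffAt r f x = diffAt r (labelSum w) x := by
  have hlr := leftPos_ne_rightPos r₀
  have hex : ∀ a : Fin n, ∃ v : ℝ, (a ∉ J → v = 0) ∧ (a = d → v = 0) ∧
      ∀ x : Equiv.Perm (Fin n), x (leftPos r₀) = a → x (rightPos r₀) = d → diffAt r₀ f x = v := by
    intro a
    by_cases had : a = d
    · refine ⟨0, fun _ => rfl, fun _ => rfl, fun x h₁ h₂ => ?_⟩
      exact absurd (x.injective (h₁.trans (had.trans h₂.symm))) hlr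
    · obtain ⟨z, hz₁, hz₂⟩ := exists_perm_apply_eq hlr had
      refine ⟨diffAt r₀ f z, fun ha => hv z (hz₁ ▸ ha) (hz₂ ▸ hd), fun h => absurd h had,
        fun x h₁ h₂ => hf.diffAt_zero_eq hr₀ (h₁.trans hz₁.symm) (h₂.trans hz₂.symm)⟩
  choose v hv₁ hv₂ hv₃ using hex
  have hzero : ∀ x : Equiv.Perm (Fin n),
      diffAt r₀ f x = v (x (leftPos r₀)) - v (x (rightPos r₀)) := by
    intro x
    by_cases hb : x (rightPos r₀) = d
    · rw [hv₃ _ x rfl hb, hv₂ _ hb, sub_zero]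
    by_cases ha : x (leftPos r₀) = d
    · rw [hv₂ _ ha, zero_sub, ← hv₃ (x (rightPos r₀)) (adjSwap x r₀) (adjSwap_leftPos _ _)
        (by rw [adjSwap_rightPos, ha]), diffAt_adjSwap, neg_neg]
    let s : Fin (n - 1) := ⟨1, by omega⟩
    have hs : (s : ℕ) = r₀ + 1 := by simp [s, hr₀]
    -- The cycle through the base label `d` expresses the change for `(a, b)` by those for `(a, d)`
    -- and `(b, d)`.
    obtain ⟨y, h₁, h₂, h₃, h₄⟩ := exists_third_label hr₀ hs hf x (Ne.symm ha) (Ne.symm hb)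
    have hc := (hf.cyclic_relations hs hp y).1
    rw [hv₃ (x (rightPos r₀)) (adjSwap (adjSwap y r₀) s)
        (by rw [adjSwap_succ_leftPos hs, adjSwap_leftPos, h₃])
        (by rw [adjSwap_succ_middle hs, adjSwap_pred_rightPos hs, h₄]), h₁] at hc
    have h₅ := hv₃ (x (leftPos r₀)) (adjSwap y s)
        (by rw [adjSwap_succ_leftPos hs, h₂]) (by rw [adjSwap_succ_middle hs, h₄])
    rw [diffAt_adjSwap, h₅] at hc
    linarith
  have hn2 : 0 < Real.sin (Real.pi / n / 2) := sin_half_pos (by omega)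
  have hu := pathVec_pos r₀
  refine ⟨fun a => v a / (2 * Real.sin (Real.pi / n / 2) * pathVec r₀),
    fun c hc => by simp only [hv₁ c hc, zero_div], fun r x => ?_⟩
  have hxr : x (leftPos r) ≠ x (rightPos r) := fun e => leftPos_ne_rightPos r (x.injective e)
  obtain ⟨z, hz₁, hz₂⟩ := exists_perm_apply_eq hlr hxr
  have e := (hf.diffAt_eq hp hJ hr₀ hv r).2 z x hz₁ hz₂
  rw [hzero z, hz₁, hz₂] at e
  rw [diffAt_labelSum, posVec_sub, ← sub_div]
  generalize Real.sin (Real.pi / n / 2) = σ at hn2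
  field_simp
  linear_combination e

theorem sub_eq_const_of_diffAt_eq {g : Equiv.Perm (Fin n) → ℝ}
    (h : ∀ r x, diffAt r f x = diffAt r g x) : ∃ c : ℝ, ∀ x, f x = g x + c := by
  refine ⟨f 1 - g 1, fun x => ?_⟩
  have := eq_of_agree (g := fun x => f x - g x) (m := 0) (x := x) (y := 1)
    (fun s z _ => by have := h s z; simp only [diffAt] at this; linarith)
    (fun i hi => absurd hi (Nat.not_lt_zero _))
  linarith

end PositionFunctions

/-! ### Explicit eigenfunctions. -/

section Eigenfunctions

variable {n : ℕ} {p : Fin n → Fin n → ℝ}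

/-- The Laplacian of the path with reflecting ends: the cosine at half-integers is symmetric about
both ends, so the three-term recurrence holds there as well. -/
theorem sum_posVec_sub_swap (hn : 2 ≤ n) (k : Fin n) :
    ∑ r : Fin (n - 1), (posVec k - posVec (Equiv.swap (leftPos r) (rightPos r) k)) =
      2 * (1 - Real.cos (Real.pi / n)) * posVec k := by
  have hn0 : (n : ℝ) ≠ 0 := by exact_mod_cast (by omega : n ≠ 0)
  have hk := k.2
  set φ : ℕ → ℝ := fun m => Real.cos (((m : ℝ) + 1 / 2) * (Real.pi / n)) with hφ
  have hpos : ∀ j : Fin n, posVec j = φ j := fun j => rfl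
  have hsplit : ∀ r : Fin (n - 1),
      posVec k - posVec (Equiv.swap (leftPos r) (rightPos r) k) =
      (if (r : ℕ) = k then φ r - φ (r + 1) else 0) +
      (if (r : ℕ) + 1 = k then φ (r + 1) - φ r else 0) := by
    intro r
    by_cases h₁ : (r : ℕ) = k
    · obtain rfl : k = leftPos r := Fin.ext h₁.symm
      rw [Equiv.swap_apply_left, if_pos h₁, if_neg (by rw [← h₁]; omega), add_zero]
      rfl
    by_cases h₂ : (r : ℕ) + 1 = k
    · obtain rfl : k = rightPos r := Fin.ext h₂.symm
      rw [Equiv.swap_apply_right, if_neg h₁, if_pos h₂, zero_add]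
      rfl
    · rw [if_neg h₁, if_neg h₂, Equiv.swap_apply_of_ne_of_ne, sub_self, add_zero]
      · exact fun e => h₁ (congrArg Fin.val e).symm
      · exact fun e => h₂ (congrArg Fin.val e).symm
  simp only [hsplit, sum_add_distrib]
  have h₁ : ∑ r : Fin (n - 1), (if (r : ℕ) = k then φ r - φ (r + 1) else 0) =
      φ k - Real.cos (((k : ℕ) + 1 / 2) * (Real.pi / n) + Real.pi / n) := by
    rw [sum_fin_ite_val_eq k fun m => φ m - φ (m + 1)]
    have e : φ (k + 1) = Real.cos (((k : ℕ) + 1 / 2) * (Real.pi / n) + Real.pi / n) := by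
      simp only [hφ]; congr 1; push_cast; ring
    rw [← e]
    split_ifs with h
    · rfl
    -- At the last position the fictitious value `φ n` equals `φ (n - 1)`.
    · have hkn : ((k : ℕ) : ℝ) + 1 = n := by exact_mod_cast (by omega : (k : ℕ) + 1 = n)
      have a₁ : (((k : ℕ) : ℝ) + 1 / 2) * (Real.pi / n) = Real.pi - Real.pi / n / 2 := by
        rw [← hkn] at hn0 ⊢; field_simp; ring
      have a₂ : (((k : ℕ) + 1 : ℕ) + 1 / 2 : ℝ) * (Real.pi / n) = Real.pi / n / 2 + Real.pi := by
        push_cast; rw [← hkn] at hn0 ⊢; field_simp; ring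
      simp only [hφ]
      rw [a₁, a₂, Real.cos_pi_sub, Real.cos_add_pi, sub_self]
  have h₂ : ∑ r : Fin (n - 1), (if (r : ℕ) + 1 = k then φ (r + 1) - φ r else 0) =
      φ k - Real.cos (((k : ℕ) + 1 / 2) * (Real.pi / n) - Real.pi / n) := by
    rcases Nat.eq_zero_or_pos (k : ℕ) with h | h
    · have a₁ : ((0 : ℕ) + 1 / 2 : ℝ) * (Real.pi / n) - Real.pi / n =
        -(((0 : ℕ) + 1 / 2 : ℝ) * (Real.pi / n)) := by push_cast; ring
      rw [h, a₁, Real.cos_neg]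
      simp [hφ]
    · have hk' : ∀ r : Fin (n - 1), ((r : ℕ) + 1 = k) = ((r : ℕ) = k - 1) := fun r => by
        apply propext; omega
      simp only [hk']
      rw [sum_fin_ite_val_eq (k - 1) fun m => φ (m + 1) - φ m, if_pos (by omega),
        Nat.sub_add_cancel h]
      congr 1
      simp only [hφ, Nat.cast_sub h]
      congr 1
      push_cast
      ring
  rw [h₁, h₂, hpos, Real.cos_add, Real.cos_sub]
  simp only [hφ]
  ring

/-- A swap involving a neutral label has rate `1/2`; any other swap does not change the function. So
the rate may be taken as `1/2` throughout, and each label feels half the path Laplacian. -/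
theorem sum_coproj_labelSum (hn : 2 ≤ n) {w : Fin n → ℝ} (hw : ∀ c, ¬ IsNeutral p c → w c = 0) :
    ∑ r, coproj p r (labelSum w) = (1 - Real.cos (Real.pi / n)) • labelSum w := by
  ext x
  have h : ∀ r, coproj p r (labelSum w) x = 1 / 2 * ∑ k,
      (posVec k - posVec (Equiv.swap (leftPos r) (rightPos r) k)) * w (x k) := by
    intro r
    have hd : diffAt r (labelSum w) x =
        ∑ k, (posVec k - posVec (Equiv.swap (leftPos r) (rightPos r) k)) * w (x k) := by
      rw [diffAt, labelSum_adjSwap, labelSum_apply, ← sum_sub_distrib]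
      simp only [sub_mul]
    have hne : x (leftPos r) ≠ x (rightPos r) := fun e => leftPos_ne_rightPos r (x.injective e)
    rw [← hd, coproj]
    by_cases h₁ : IsNeutral p (x (leftPos r))
    · rw [h₁.half_right hne.symm]
    by_cases h₂ : IsNeutral p (x (rightPos r))
    · rw [h₂.half_left hne]
    · rw [diffAt_labelSum, hw _ h₁, hw _ h₂]
      ring
  simp only [Finset.sum_apply, h, Pi.smul_apply, smul_eq_mul, labelSum_apply]
  rw [← mul_sum, Finset.sum_comm]
  simp only [← sum_mul, sum_posVec_sub_swap hn, mul_sum]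
  exact Finset.sum_congr rfl fun k _ => by ring

/-- The eigenfunction that arises from two labels `a` and `b` when all other labels are
neutral. -/
noncomputable def pairFun (p : Fin n → Fin n → ℝ) (a b : Fin n) (x : Equiv.Perm (Fin n)) : ℝ :=
  (posVec (x.symm a) - posVec (x.symm b)) * if x.symm a < x.symm b then p b a else p a b

theorem diffAt_pairFun (hp : IsParameterVector p) {a b : Fin n} (hab : a ≠ b) {r : Fin (n - 1)}
    {x : Equiv.Perm (Fin n)} (ha : x (leftPos r) = a) (hb : x (rightPos r) = b) :
    diffAt r (pairFun p a b) x = posVec (leftPos r) - posVec (rightPos r) := by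
  have ha' : x.symm a = leftPos r := by rw [Equiv.symm_apply_eq, ha]
  have hb' : x.symm b = rightPos r := by rw [Equiv.symm_apply_eq, hb]
  simp only [diffAt, pairFun, adjSwap_symm_apply, ha', hb', Equiv.swap_apply_left,
    Equiv.swap_apply_right, if_pos (leftPos_lt_rightPos r), if_neg (leftPos_lt_rightPos r).not_gt]
  linear_combination (posVec (leftPos r) - posVec (rightPos r)) * hp.add_eq_one a b hab

/-- When `a` and `b` trade places, the rate is the order factor itself, and `p a b + p b a = 1`
makes the change the full position difference. Any other swap involves a neutral label, has rate
`1/2`, and keeps the order factor. -/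
theorem coproj_pairFun (hp : IsParameterVector p) {a b : Fin n} (hab : a ≠ b)
    (hJ : ∀ c, c ≠ a → c ≠ b → IsNeutral p c) (r : Fin (n - 1)) (x : Equiv.Perm (Fin n)) :
    coproj p r (pairFun p a b) x = 1 / 2 * (if x.symm a < x.symm b then p b a else p a b) *
      ((posVec (x.symm a) - posVec (Equiv.swap (leftPos r) (rightPos r) (x.symm a))) -
        (posVec (x.symm b) - posVec (Equiv.swap (leftPos r) (rightPos r) (x.symm b)))) := by
  have hne : x (leftPos r) ≠ x (rightPos r) := fun e => leftPos_ne_rightPos r (x.injective e)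
  by_cases h₁ : x (leftPos r) = a ∧ x (rightPos r) = b
  · have ha' : x.symm a = leftPos r := by rw [Equiv.symm_apply_eq, h₁.1]
    have hb' : x.symm b = rightPos r := by rw [Equiv.symm_apply_eq, h₁.2]
    rw [coproj, diffAt_pairFun hp hab h₁.1 h₁.2, ha', hb', Equiv.swap_apply_left,
      Equiv.swap_apply_right, if_pos (leftPos_lt_rightPos r), h₁.1, h₁.2]
    ring
  by_cases h₂ : x (leftPos r) = b ∧ x (rightPos r) = a
  · have ha' : x.symm a = rightPos r := by rw [Equiv.symm_apply_eq, h₂.2]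
    have hb' : x.symm b = leftPos r := by rw [Equiv.symm_apply_eq, h₂.1]
    have hd := diffAt_pairFun hp hab (r := r) (x := adjSwap x r) (by rw [adjSwap_leftPos, h₂.2])
      (by rw [adjSwap_rightPos, h₂.1])
    rw [diffAt_adjSwap] at hd
    rw [coproj, ha', hb', Equiv.swap_apply_left, neg_eq_iff_eq_neg.1 hd,
      Equiv.swap_apply_right, if_neg (leftPos_lt_rightPos r).not_gt, h₂.1, h₂.2]
    ring
  have hhalf : p (x (rightPos r)) (x (leftPos r)) = 1 / 2 := by
    by_cases hl : x (leftPos r) = a ∨ x (leftPos r) = b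
    · refine (hJ (x (rightPos r)) ?_ ?_).half_left hne
      · rintro h
        rcases hl with hl | hl
        · exact hne (hl.trans h.symm)
        · exact h₂ ⟨hl, h⟩
      · rintro h
        rcases hl with hl | hl
        · exact h₁ ⟨hl, h⟩
        · exact hne (hl.trans h.symm)
    · push Not at hl
      exact (hJ _ hl.1 hl.2).half_right hne.symm
  have hiff : (Equiv.swap (leftPos r) (rightPos r) (x.symm a) <
      Equiv.swap (leftPos r) (rightPos r) (x.symm b)) = (x.symm a < x.symm b) := by
    apply propext
    constructor
    · intro h
      by_contra hle
      have hlt : x.symm b < x.symm a :=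
        lt_of_le_of_ne (not_lt.1 hle) fun e => hab (x.symm.injective e).symm
      refine absurd h (swap_lt_swap (r := r) hlt fun e => h₂ ?_).not_gt
      simp only [Prod.mk.injEq, Equiv.symm_apply_eq] at e
      exact ⟨e.1.symm, e.2.symm⟩
    · intro h
      refine swap_lt_swap h fun e => h₁ ?_
      simp only [Prod.mk.injEq, Equiv.symm_apply_eq] at e
      exact ⟨e.1.symm, e.2.symm⟩
  rw [coproj, hhalf, diffAt, pairFun, pairFun, adjSwap_symm_apply, adjSwap_symm_apply]
  simp only [hiff]
  ring

theorem sum_coproj_pairFun (hn : 2 ≤ n) (hp : IsParameterVector p) {a b : Fin n} (hab : a ≠ b)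
    (hJ : ∀ c, c ≠ a → c ≠ b → IsNeutral p c) :
    ∑ r, coproj p r (pairFun p a b) = (1 - Real.cos (Real.pi / n)) • pairFun p a b := by
  ext x
  simp only [Finset.sum_apply, coproj_pairFun hp hab hJ, Pi.smul_apply, smul_eq_mul]
  rw [← mul_sum, sum_sub_distrib, sum_posVec_sub_swap hn, sum_posVec_sub_swap hn, pairFun]
  ring

end Eigenfunctions

/-! ### Eigenvalues, multiplicities and the gap. -/

section Spectrum

variable {n : ℕ} {p : Fin n → Fin n → ℝ}

theorem statInner_transitionMatrix_left (hn : 2 ≤ n) (hp : IsParameterVector p)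
    (f g : Equiv.Perm (Fin n) → ℝ) :
    statInner p ((transitionMatrix p).mulVec f) g =
      statInner p f ((transitionMatrix p).mulVec g) := by
  simp only [transitionMatrix_mulVec hn hp, sub_eq_add_neg, ← neg_one_smul ℝ (_ • _),
    statInner_add_left, statInner_add_right, statInner_smul_left, statInner_smul_right,
    statInner_sum_left, statInner_sum_right, statInner_coproj_left]

/-- Self-adjointness for a positive definite form excludes nontrivial Jordan blocks. -/
theorem rootMultiplicity_charpoly_eq_finrank (hn : 2 ≤ n) (hp : IsParameterVector p) (μ : ℝ) :
    (transitionMatrix p).charpoly.rootMultiplicity μ =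
      Module.finrank ℝ (Module.End.eigenspace (transitionMatrix p).toLin' μ) := by
  rw [← Matrix.charpoly_toLin', ← LinearMap.finrank_maxGenEigenspace_eq]
  suffices h : Module.End.maxGenEigenspace (transitionMatrix p).toLin' μ =
      Module.End.eigenspace (transitionMatrix p).toLin' μ by rw [h]
  set T := (transitionMatrix p).toLin' - algebraMap ℝ (Module.End ℝ _) μ with hT
  have hTapp : ∀ f, T f = (transitionMatrix p).mulVec f + (-μ) • f := by
    intro f
    rw [hT, neg_smul, ← sub_eq_add_neg]
    rfl
  have hsa : ∀ f g, statInner p (T f) g = statInner p f (T g) := by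
    intro f g
    simp only [hTapp, statInner_add_left, statInner_add_right,
      statInner_smul_left, statInner_smul_right, statInner_transitionMatrix_left hn hp]
  have hpow : ∀ k f, (T ^ (k + 1)) f = 0 → T f = 0 := by
    intro k
    induction k with
    | zero => intro f h; simpa using h
    | succ k ih =>
      intro f h
      -- `‖T^(k+1) f‖² = ⟨T^k f, T^(k+2) f⟩ = 0`.
      refine ih f (statInner_self_eq_zero hp ?_)
      rw [pow_succ', Module.End.mul_apply, hsa, ← Module.End.mul_apply, ← Module.End.mul_apply,
        mul_assoc, ← pow_succ', ← pow_succ', h]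
      simp [statInner]
  apply le_antisymm
  · intro f hf
    rw [Module.End.mem_maxGenEigenspace] at hf
    obtain ⟨k, hk⟩ := hf
    rw [Module.End.mem_eigenspace_iff]
    have h₁ : T f = 0 := by
      apply hpow k
      have : (T ^ k) f = 0 := hk
      rw [pow_succ', Module.End.mul_apply, this, map_zero]
    rw [hT, LinearMap.sub_apply, Module.algebraMap_end_apply, sub_eq_zero] at h₁
    exact h₁
  · exact Module.End.genEigenspace_le_maximal _ _ 1

theorem mem_eigenspace_transitionMatrix (hn : 2 ≤ n) (hp : IsParameterVector p) {μ : ℝ}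
    {f : Equiv.Perm (Fin n) → ℝ} :
    f ∈ Module.End.eigenspace (transitionMatrix p).toLin' μ ↔
      ∑ r, coproj p r f = ((1 - μ) * ((n : ℝ) - 1)) • f := by
  have hn' : (n : ℝ) - 1 ≠ 0 := by
    have : (2 : ℝ) ≤ n := by exact_mod_cast hn
    linarith
  rw [Module.End.mem_eigenspace_iff, Matrix.toLin'_apply, transitionMatrix_mulVec hn hp]
  simp only [funext_iff, Pi.sub_apply, Pi.smul_apply, smul_eq_mul]
  refine forall_congr' fun x => ?_
  constructor
  · intro h
    field_simp at h
    linear_combination -h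
  · intro h
    rw [h]
    field_simp
    ring

theorem mem_eigenspace_gapStar (hn : 2 ≤ n) (hp : IsParameterVector p)
    {f : Equiv.Perm (Fin n) → ℝ} :
    f ∈ Module.End.eigenspace (transitionMatrix p).toLin' (1 - gapStar n) ↔
      ∑ r, coproj p r f = (1 - Real.cos (Real.pi / n)) • f := by
  have hn' : (n : ℝ) - 1 ≠ 0 := by
    have : (2 : ℝ) ≤ n := by exact_mod_cast hn
    linarith
  rw [mem_eigenspace_transitionMatrix hn hp, sub_sub_cancel, gapStar, div_mul_cancel₀ _ hn']

theorem one_sub_cos_pos (hn : 2 ≤ n) : 0 < 1 - Real.cos (Real.pi / n) := by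
  have := sin_half_pos hn
  rw [show Real.pi / n = 2 * (Real.pi / n / 2) by ring, Real.cos_two_mul']
  nlinarith [Real.sin_sq_add_cos_sq (Real.pi / n / 2)]

/-- On an eigenvector of `D` with eigenvalue `ν ≥ 0` the spectral inequality reads `γ ν ≤ ν²`, so `ν
= 0` or `ν ≥ γ`. -/
theorem eq_one_or_le_of_isRoot (hn : 2 ≤ n) (hp : IsRegularParameterVector p) {μ : ℝ}
    (hμ : (transitionMatrix p).charpoly.IsRoot μ) : μ = 1 ∨ μ ≤ 1 - gapStar n := by
  have hp' := hp.toIsParameterVector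
  have hn' : 0 < (n : ℝ) - 1 := by
    have : (2 : ℝ) ≤ n := by exact_mod_cast hn
    linarith
  rw [← Matrix.charpoly_toLin', ← Module.End.hasEigenvalue_iff_isRoot_charpoly] at hμ
  obtain ⟨f, hf, hf₀⟩ := hμ.exists_hasEigenvector
  rw [mem_eigenspace_transitionMatrix hn hp'] at hf
  set ν := (1 - μ) * ((n : ℝ) - 1) with hν
  have hpos : 0 < statInner p f f := lt_of_le_of_ne (statInner_self_nonneg hp' f)
    fun h => hf₀ (statInner_self_eq_zero hp' h.symm)
  have h₁ : 0 ≤ ν * statInner p f f := by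
    rw [← statInner_smul_left, ← hf, statInner_sum_coproj hp']
    exact Finset.sum_nonneg fun r _ => statInner_self_nonneg hp' _
  have h₂ := spectral_inequality hp f
  rw [hf, statInner_smul_left, statInner_smul_left, statInner_smul_right] at h₂
  have hν₀ : 0 ≤ ν := nonneg_of_mul_nonneg_left h₁ hpos
  rcases hν₀.eq_or_lt with h | h
  · left
    have := (mul_eq_zero.1 (hν.symm.trans h.symm)).resolve_right hn'.ne'
    linarith
  · right
    have h₃ : 1 - Real.cos (Real.pi / n) ≤ ν := by
      have : (1 - Real.cos (Real.pi / n)) * (ν * statInner p f f) ≤ ν * (ν * statInner p f f) := h₂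
      exact le_of_mul_le_mul_right this (by positivity)
    have : gapStar n ≤ 1 - μ := by
      rw [gapStar, div_le_iff₀ hn']
      exact h₃
    linarith

/-- If `Df = 0`, every `P_r f` vanishes; since adjacent transpositions connect all states, `f` is
constant. -/
theorem rootMultiplicity_one (hn : 2 ≤ n) (hp : IsParameterVector p) :
    (transitionMatrix p).charpoly.rootMultiplicity 1 = 1 := by
  rw [rootMultiplicity_charpoly_eq_finrank hn hp]
  have hmem : (fun _ => 1 : Equiv.Perm (Fin n) → ℝ) ∈
      Module.End.eigenspace (transitionMatrix p).toLin' 1 := by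
    rw [mem_eigenspace_transitionMatrix hn hp]
    ext x
    simp [coproj, diffAt]
  refine (finrank_eq_one_iff_of_nonzero' (⟨_, hmem⟩ : Module.End.eigenspace _ _) ?_).2 ?_
  · intro h
    have := congrFun (congrArg Subtype.val h) 1
    simp at this
  · rintro ⟨f, hf⟩
    rw [mem_eigenspace_transitionMatrix hn hp, sub_self, zero_mul, zero_smul] at hf
    have hs := statInner_sum_coproj hp f
    rw [hf] at hs
    have h0 : statInner p (0 : Equiv.Perm (Fin n) → ℝ) f = 0 := by simp [statInner]
    rw [h0] at hs
    have hz := (Finset.sum_eq_zero_iff_of_nonneg fun r _ => statInner_self_nonneg hp _).1 hs.symm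
    obtain ⟨c, hc⟩ := sub_eq_const_of_diffAt_eq (f := f) (g := 0) fun r x => by
      have h := congrFun (statInner_self_eq_zero hp (hz r (mem_univ r))) x
      have := (mul_eq_zero.1 h).resolve_left (hp.label_pos x (leftPos_ne_rightPos r).symm).ne'
      rw [this]
      simp [diffAt]
    refine ⟨c, Subtype.ext (funext fun x => ?_)⟩
    simp [hc x]

theorem gapStar_pos (hn : 2 ≤ n) : 0 < gapStar n := by
  have : (2 : ℝ) ≤ n := by exact_mod_cast hn
  exact div_pos (one_sub_cos_pos hn) (by linarith)

/-- Keeps `1 - λ*` away from `0`, the default value in `secondLargestEigenvalue`. -/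
theorem gapStar_lt_one (hn : 3 ≤ n) : gapStar n < 1 := by
  have hn' : (3 : ℝ) ≤ n := by exact_mod_cast hn
  rw [gapStar, div_lt_one (by linarith)]
  have : 0 < Real.cos (Real.pi / n) := by
    apply Real.cos_pos_of_mem_Ioo
    have := Real.pi_pos
    constructor
    · have : 0 < Real.pi / n := by positivity
      linarith
    · exact div_lt_div_of_pos_left this two_pos (by linarith)
  linarith

theorem getD_one_sort_eq_iff {m : Multiset ℝ} {a b : ℝ} (hab : b < a) (hb : b ≠ 0)
    (ha : m.count a = 1) (hm : ∀ x ∈ m, x = a ∨ x ≤ b) :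
    (m.sort (· ≥ ·)).getD 1 0 = b ↔ b ∈ m := by
  have hmem : ∀ x, x ∈ m.sort (· ≥ ·) ↔ x ∈ m := fun x => Multiset.mem_sort _
  have hsorted := m.pairwise_sort (· ≥ ·)
  have hcount : (m.sort (· ≥ ·)).count a = 1 := by
    rw [← ha, ← Multiset.coe_count, Multiset.sort_eq]
  have ham : a ∈ m := Multiset.one_le_count_iff_mem.1 ha.ge
  rw [← hmem] at ham ⊢
  have hm' : ∀ x ∈ m.sort (· ≥ ·), x = a ∨ x ≤ b := fun x hx => hm x ((hmem x).1 hx)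
  clear hmem
  generalize m.sort (· ≥ ·) = l at *
  match l with
  | [] => simp at ham
  -- Here the second entry is the default `0`, which `hb` separates from `b`.
  | [c] =>
    simp only [List.mem_singleton] at ham ⊢
    simp [ham ▸ hab.ne, hb.symm]
  | c :: d :: t =>
    simp only [List.pairwise_cons, List.mem_cons] at hsorted
    have hca : c = a := by
      rcases hm' c (by simp) with h | h
      · exact h
      · rcases List.mem_cons.1 ham with h' | h'
        · exact h'.symm
        · have := hsorted.1 a (List.mem_cons.1 h')
          linarith
    subst hca
    rw [List.count_cons_self, Nat.add_eq_right, List.count_eq_zero] at hcount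
    have hd : d ≤ b := (hm' d (by simp)).resolve_left fun h => hcount (by simp [h])
    simp only [List.getD_cons_succ, List.getD_cons_zero, List.mem_cons]
    constructor
    · exact fun h => Or.inr (Or.inl h.symm)
    · rintro (h | h | h)
      · exact absurd h hab.ne
      · exact h.symm
      · exact le_antisymm hd (hsorted.2.1 b h)

theorem spectralGap_eq_gapStar_iff (hn : 3 ≤ n) (hp : IsRegularParameterVector p) :
    spectralGap p = gapStar n ↔ 1 ≤ gapMultiplicity p := by
  have h₀ := (transitionMatrix p).charpoly_monic.ne_zero
  have h₁ : (1 - gapStar n : ℝ) < 1 := by linarith [gapStar_pos (n := n) (by omega)]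
  have h₂ : (1 - gapStar n : ℝ) ≠ 0 := by linarith [gapStar_lt_one hn]
  rw [gapMultiplicity, ← Polynomial.count_roots, Multiset.one_le_count_iff_mem,
    ← getD_one_sort_eq_iff h₁ h₂, spectralGap, secondLargestEigenvalue]
  · constructor <;> intro h <;> linarith
  · rw [Polynomial.count_roots, rootMultiplicity_one (by omega) hp.toIsParameterVector]
  · intro x hx
    exact eq_one_or_le_of_isRoot (by omega) hp ((Polynomial.mem_roots h₀).1 hx)

end Spectrum

/-! ### Equality in the cycle bound forces neutral labels. -/

section Neutral

variable {n : ℕ} {p : Fin n → Fin n → ℝ}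

/-- Monotonicity squeezes every comparison with `c` between `1/2` and its comparison with an extreme
label. -/
theorem IsRegularParameterVector.isNeutral_of_extreme (hp : IsRegularParameterVector p)
    {lo hi : Fin n} (hlo : ∀ i, lo ≤ i) (hhi : ∀ i, i ≤ hi) {c : Fin n}
    (h₁ : lo < c → p lo c = 1 / 2) (h₂ : c < hi → p c hi = 1 / 2) : IsNeutral p c := by
  have hp' := hp.toIsParameterVector
  intro i hi'
  rcases lt_or_gt_of_ne hi' with h | h
  · have hle := hp.le_of_le_left (hlo i) h
    rw [h₁ ((hlo i).trans_lt h)] at hle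
    have := le_antisymm hle (hp.half_le_of_lt h)
    exact ⟨(hp'.half_comm hi').1 this, this⟩
  · have hle := hp.le_of_le_right h (hhi i)
    rw [h₂ (h.trans_le (hhi i))] at hle
    have := le_antisymm hle (hp.half_le_of_lt h)
    exact ⟨this, (hp'.half_comm hi').2 this⟩

theorem IsRegularParameterVector.isNeutral_of_half (hp : IsRegularParameterVector p)
    {lo hi : Fin n} (hlo : ∀ i, lo ≤ i) (hhi : ∀ i, i ≤ hi) (h : p lo hi = 1 / 2) (c : Fin n) :
    IsNeutral p c :=
  hp.isNeutral_of_extreme hlo hhi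
    (fun hc => le_antisymm ((hp.le_of_le_right hc (hhi c)).trans h.le) (hp.half_le_of_lt hc))
    (fun hc => le_antisymm ((hp.le_of_le_left (hlo c) hc).trans h.le) (hp.half_le_of_lt hc))

variable {f : Equiv.Perm (Fin n) → ℝ}

theorem IsTight.cycleProb_eq (hf : IsTight p f) (hn : 3 ≤ n) {r₀ : Fin (n - 1)}
    (hr₀ : (r₀ : ℕ) = 0) {x : Equiv.Perm (Fin n)} (hx : diffAt r₀ f x ≠ 0) {c : Fin n}
    (h₁ : c ≠ x (leftPos r₀)) (h₂ : c ≠ x (rightPos r₀)) :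
    cycleProb p (x (leftPos r₀)) (x (rightPos r₀)) c = 1 / 4 := by
  have hs : ((⟨1, by omega⟩ : Fin (n - 1)) : ℕ) = r₀ + 1 := by simp [hr₀]
  obtain ⟨y, e₁, e₂, e₃, e₄⟩ := exists_third_label hr₀ hs hf x h₁ h₂
  by_contra hne
  apply hx
  rw [← e₁]
  refine (hf.vanish r₀ _ y hs ?_).1
  rwa [blockCoef, e₂, e₃, e₄]

theorem IsTight.diffAt_eq_zero_of_min (hf : IsTight p f) (hn : 3 ≤ n)
    (hp : IsRegularParameterVector p) {lo hi : Fin n} (hlo : ∀ i, lo ≤ i) (hhi : ∀ i, i ≤ hi)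
    {r₀ : Fin (n - 1)} (hr₀ : (r₀ : ℕ) = 0) {x : Equiv.Perm (Fin n)}
    (hx : x (leftPos r₀) = lo) (hb : x (rightPos r₀) < hi)
    (hb' : ¬ IsNeutral p (x (rightPos r₀))) : diffAt r₀ f x = 0 := by
  by_contra hne
  have hlt : lo < x (rightPos r₀) := lt_of_le_of_ne (hlo _) fun e =>
    leftPos_ne_rightPos r₀ (x.injective (hx.trans e))
  have h := hf.cycleProb_eq hn hr₀ hne (c := hi) (by rw [hx]; exact (hlt.trans hb).ne') hb.ne'
  rw [hx] at h
  obtain ⟨h₁, h₂⟩ := (hp.cycleProb_of_lt hlt hb).2 h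
  exact hb' (hp.isNeutral_of_extreme hlo hhi (fun _ => h₁) fun _ => h₂)

/-- If the pair contains an extreme label, a nonzero change makes the cycle bound an equality for a
suitable third label (the other extreme, or the one from `hmid`), and this would make a non-neutral
label neutral. -/
theorem IsTight.diffAt_eq_zero_of_lt (hf : IsTight p f) (hn : 3 ≤ n)
    (hp : IsRegularParameterVector p) {lo hi : Fin n} (hlo : ∀ i, lo ≤ i) (hhi : ∀ i, i ≤ hi)
    (hmid : ∃ c, c ≠ lo ∧ c ≠ hi ∧ ¬ IsNeutral p c)
    {r₀ : Fin (n - 1)} (hr₀ : (r₀ : ℕ) = 0) {x : Equiv.Perm (Fin n)}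
    (hlt : x (leftPos r₀) < x (rightPos r₀)) (ha : ¬ IsNeutral p (x (leftPos r₀)))
    (hb : ¬ IsNeutral p (x (rightPos r₀))) : diffAt r₀ f x = 0 := by
  rcases (hhi (x (rightPos r₀))).eq_or_lt with hbhi | hbhi
  · by_contra hne
    rcases (hlo (x (leftPos r₀))).eq_or_lt with halo | halo
    · obtain ⟨c, hc₁, hc₂, hc⟩ := hmid
      have h := hf.cycleProb_eq hn hr₀ hne (c := c) (by rwa [← halo]) (by rwa [hbhi])
      rw [← halo, hbhi, cycleProb_swap_right] at h
      obtain ⟨h₁, h₂⟩ := (hp.cycleProb_of_lt (lt_of_le_of_ne (hlo c) hc₁.symm)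
        (lt_of_le_of_ne (hhi c) hc₂)).2 h
      exact hc (hp.isNeutral_of_extreme hlo hhi (fun _ => h₁) fun _ => h₂)
    · have h := hf.cycleProb_eq hn hr₀ hne (c := lo) halo.ne (halo.trans hlt).ne
      rw [cycleProb_swap_right, cycleProb_swap_left] at h
      rw [hbhi] at h hlt
      obtain ⟨h₁, h₂⟩ := (hp.cycleProb_of_lt halo hlt).2 h
      exact ha (hp.isNeutral_of_extreme hlo hhi (fun _ => h₁) fun _ => h₂)
  · rcases (hlo (x (leftPos r₀))).eq_or_lt with halo | halo
    · exact hf.diffAt_eq_zero_of_min hn hp hlo hhi hr₀ halo.symm hbhi hb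
    -- For two inner labels equality does not yield neutrality directly; the cycle through `lo`
    -- reduces the change to two that contain `lo`.
    · have hs : ((⟨1, by omega⟩ : Fin (n - 1)) : ℕ) = r₀ + 1 := by simp [hr₀]
      obtain ⟨y, e₁, e₂, e₃, e₄⟩ := exists_third_label hr₀ hs hf x halo.ne (halo.trans hlt).ne
      have hc := (hf.cyclic_relations hs hp.toIsParameterVector y).1
      set s : Fin (n - 1) := ⟨1, by omega⟩
      have h₁ : diffAt r₀ f (adjSwap (adjSwap (adjSwap y r₀) s) r₀) = 0 := by
        apply hf.diffAt_eq_zero_of_min hn hp hlo hhi hr₀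
        · rw [adjSwap_leftPos, adjSwap_succ_middle hs, adjSwap_pred_rightPos hs, e₄]
        · rwa [adjSwap_rightPos, adjSwap_succ_leftPos hs, adjSwap_leftPos, e₃]
        · rwa [adjSwap_rightPos, adjSwap_succ_leftPos hs, adjSwap_leftPos, e₃]
      have h₂ : diffAt r₀ f (adjSwap (adjSwap y s) r₀) = 0 := by
        apply hf.diffAt_eq_zero_of_min hn hp hlo hhi hr₀
        · rw [adjSwap_leftPos, adjSwap_succ_middle hs, e₄]
        · rw [adjSwap_rightPos, adjSwap_succ_leftPos hs, e₂]
          exact hlt.trans hbhi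
        · rwa [adjSwap_rightPos, adjSwap_succ_leftPos hs, e₂]
      rw [diffAt_adjSwap, neg_eq_zero] at h₁
      rw [h₁, h₂, e₁] at hc
      simpa using hc

theorem IsTight.vanishesOutside_neutral (hf : IsTight p f) (hn : 3 ≤ n)
    (hp : IsRegularParameterVector p) {lo hi : Fin n} (hlo : ∀ i, lo ≤ i) (hhi : ∀ i, i ≤ hi)
    (hmid : ∃ c, c ≠ lo ∧ c ≠ hi ∧ ¬ IsNeutral p c)
    {r₀ : Fin (n - 1)} (hr₀ : (r₀ : ℕ) = 0) :
    VanishesOutside {c | IsNeutral p c} f r₀ := by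
  intro x h₁ h₂
  rcases lt_or_gt_of_ne fun e => leftPos_ne_rightPos r₀ (x.injective e) with h | h
  · exact hf.diffAt_eq_zero_of_lt hn hp hlo hhi hmid hr₀ h h₁ h₂
  · rw [← neg_eq_zero, ← diffAt_adjSwap]
    apply hf.diffAt_eq_zero_of_lt hn hp hlo hhi hmid hr₀ <;>
      simpa only [adjSwap_leftPos, adjSwap_rightPos]

end Neutral

/-! ### Dimension of the eigenspace. -/

section Multiplicity

variable {n : ℕ} {p : Fin n → Fin n → ℝ}

/-- Equal changes give equal images under `D`; both functions have the nonzero eigenvalue `γ`, so no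
additive constant survives. -/
theorem exists_eq_labelSum (hn : 3 ≤ n) (hp : IsRegularParameterVector p)
    {f : Equiv.Perm (Fin n) → ℝ}
    (hf : ∑ r, coproj p r f = (1 - Real.cos (Real.pi / n)) • f) {J : Set (Fin n)}
    (hJ : ∀ c ∈ J, IsNeutral p c) {d : Fin n} (hd : d ∉ J) {r₀ : Fin (n - 1)}
    (hr₀ : (r₀ : ℕ) = 0) (hv : VanishesOutside J f r₀) :
    ∃ w : Fin n → ℝ, (∀ c ∉ J, w c = 0) ∧ f = labelSum w := by
  obtain ⟨w, hw, h⟩ := (isTight_of_eigenfunction hp hf).exists_labelSum hn hp.toIsParameterVector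
    hJ hd hr₀ hv
  refine ⟨w, hw, ?_⟩
  obtain ⟨c, hc⟩ := sub_eq_const_of_diffAt_eq h
  have h₁ : ∑ r, coproj p r f = ∑ r, coproj p r (labelSum w) :=
    Finset.sum_congr rfl fun r _ => by ext x; rw [coproj, coproj, h]
  rw [hf, sum_coproj_labelSum (by omega) fun c hc => hw c fun h => hc (hJ c h)] at h₁
  exact smul_right_injective _ (one_sub_cos_pos (by omega)).ne' h₁

/-- The entries of `posVec` sum to zero, so constant `w` lie in the kernel; the zero at `d` removes
them. -/
theorem eq_zero_of_labelSum_eq_zero (hn : 2 ≤ n) {w : Fin n → ℝ} {d : Fin n} (hd : w d = 0)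
    (h : labelSum w = 0) : w = 0 := by
  ext c
  by_cases hcd : c = d
  · rw [hcd, hd, Pi.zero_apply]
  let r₀ : Fin (n - 1) := ⟨0, by omega⟩
  obtain ⟨x, h₁, h₂⟩ := exists_perm_apply_eq (leftPos_ne_rightPos r₀) hcd
  have := diffAt_labelSum w r₀ x
  rw [h, h₁, h₂, hd, posVec_sub, sub_zero] at this
  have hs := sin_half_pos hn
  have hu := pathVec_pos r₀
  exact (mul_eq_zero.1 ((show diffAt r₀ 0 x = 0 by simp [diffAt]).symm.trans this).symm).resolve_left
    (by positivity)

/-- Extension by zero of a function on a set of labels. -/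
noncomputable def extendLabels (J : Set (Fin n)) : (J → ℝ) →ₗ[ℝ] (Fin n → ℝ) :=
  Function.ExtendByZero.linearMap ℝ Subtype.val

theorem extendLabels_of_notMem {J : Set (Fin n)} (v : J → ℝ) {c : Fin n} (hc : c ∉ J) :
    extendLabels J v c = 0 :=
  Function.extend_apply' _ _ _ fun ⟨a, ha⟩ => hc (ha ▸ a.2)

theorem extendLabels_coe {J : Set (Fin n)} (v : J → ℝ) (c : J) : extendLabels J v c = v c :=
  Subtype.val_injective.extend_apply _ _ _

theorem exists_extendLabels {J : Set (Fin n)} {w : Fin n → ℝ} (hw : ∀ c ∉ J, w c = 0) :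
    ∃ v, extendLabels J v = w := by
  refine ⟨fun c => w c, funext fun c => ?_⟩
  by_cases hc : c ∈ J
  · exact extendLabels_coe _ ⟨c, hc⟩
  · rw [extendLabels_of_notMem _ hc, hw c hc]

theorem eq_zero_of_extendLabels_eq_zero {J : Set (Fin n)} {v : J → ℝ}
    (h : extendLabels J v = 0) : v = 0 := by
  ext c
  rw [← extendLabels_coe v c, h]
  rfl

theorem finrank_labels (J : Set (Fin n)) : Module.finrank ℝ (J → ℝ) = J.ncard := by
  classical
  rw [Module.finrank_fintype_fun_eq_card, ← Nat.card_eq_fintype_card, Nat.card_coe_set_eq]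

theorem gapMultiplicity_of_exists_not_neutral (hn : 3 ≤ n) (hp : IsRegularParameterVector p)
    {lo hi : Fin n} (hlo : ∀ i, lo ≤ i) (hhi : ∀ i, i ≤ hi)
    (hmid : ∃ c, c ≠ lo ∧ c ≠ hi ∧ ¬ IsNeutral p c) : gapMultiplicity p = numNeutral p := by
  have hp' := hp.toIsParameterVector
  have hn2 : 2 ≤ n := by omega
  set J : Set (Fin n) := {c | IsNeutral p c}
  obtain ⟨d, hdlo, hdhi, hd⟩ := hmid
  have hdJ : d ∉ J := hd
  let Θ := labelSum ∘ₗ extendLabels J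
  have hinj : Function.Injective Θ := by
    rw [← LinearMap.ker_eq_bot, LinearMap.ker_eq_bot']
    intro v hv
    exact eq_zero_of_extendLabels_eq_zero
      (eq_zero_of_labelSum_eq_zero hn2 (extendLabels_of_notMem v hdJ) hv)
  have hrange : Module.End.eigenspace (transitionMatrix p).toLin' (1 - gapStar n) =
      LinearMap.range Θ := by
    ext f
    rw [mem_eigenspace_gapStar hn2 hp', LinearMap.mem_range]
    constructor
    · intro hf
      let r₀ : Fin (n - 1) := ⟨0, by omega⟩
      have hv := (isTight_of_eigenfunction hp hf).vanishesOutside_neutral hn hp hlo hhi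
        ⟨d, hdlo, hdhi, hd⟩ (r₀ := r₀) rfl
      obtain ⟨w, hw, rfl⟩ := exists_eq_labelSum hn hp hf (fun _ hc => hc) hdJ rfl hv
      obtain ⟨v, rfl⟩ := exists_extendLabels hw
      exact ⟨v, rfl⟩
    · rintro ⟨v, rfl⟩
      exact sum_coproj_labelSum hn2 fun c hc => extendLabels_of_notMem v hc
  rw [gapMultiplicity, rootMultiplicity_charpoly_eq_finrank hn2 hp', hrange,
    LinearMap.finrank_range_of_inj hinj, finrank_labels]
  rfl

theorem diffAt_sub_smul (r : Fin (n - 1)) (f g : Equiv.Perm (Fin n) → ℝ) (κ : ℝ)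
    (x : Equiv.Perm (Fin n)) : diffAt r (f - κ • g) x = diffAt r f x - κ * diffAt r g x := by
  simp only [diffAt, Pi.sub_apply, Pi.smul_apply, smul_eq_mul]
  ring

theorem coproj_sub_smul (r : Fin (n - 1)) (f g : Equiv.Perm (Fin n) → ℝ) (κ : ℝ) :
    coproj p r (f - κ • g) = coproj p r f - κ • coproj p r g := by
  ext x
  simp only [coproj, diffAt_sub_smul, Pi.sub_apply, Pi.smul_apply, smul_eq_mul]
  ring

theorem gapMultiplicity_of_forall_neutral (hn : 3 ≤ n) (hp : IsRegularParameterVector p)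
    {a b : Fin n} (hab : a ≠ b) (hJ : ∀ c, c ≠ a → c ≠ b → IsNeutral p c) :
    gapMultiplicity p = n - 1 := by
  have hp' := hp.toIsParameterVector
  have hn2 : 2 ≤ n := by omega
  -- Even if `a` and `b` are neutral they are left out, so one argument covers `n - 2` and `n`
  -- neutral labels.
  set J : Set (Fin n) := {a, b}ᶜ with hJdef
  have hmemJ : ∀ c, c ∈ J ↔ c ≠ a ∧ c ≠ b := fun c => by simp [hJdef]
  have hJ' : ∀ c ∈ J, IsNeutral p c := fun c hc => hJ c ((hmemJ c).1 hc).1 ((hmemJ c).1 hc).2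
  have haJ : a ∉ J := fun h => ((hmemJ a).1 h).1 rfl
  have hbJ : b ∉ J := fun h => ((hmemJ b).1 h).2 rfl
  let r₀ : Fin (n - 1) := ⟨0, by omega⟩
  obtain ⟨x₀, hxa, hxb⟩ := exists_perm_apply_eq (leftPos_ne_rightPos r₀) hab
  have hpair : diffAt r₀ (pairFun p a b) x₀ ≠ 0 := by
    rw [diffAt_pairFun hp' hab hxa hxb, posVec_sub]
    have := sin_half_pos hn2
    have := pathVec_pos r₀
    positivity
  have hlabel : ∀ v : J → ℝ, diffAt r₀ (labelSum (extendLabels J v)) x₀ = 0 := fun v => by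
    rw [diffAt_labelSum, hxa, hxb, extendLabels_of_notMem v haJ, extendLabels_of_notMem v hbJ,
      sub_self, mul_zero]
  let Θ := (labelSum ∘ₗ extendLabels J).coprod (LinearMap.toSpanSingleton ℝ _ (pairFun p a b))
  have hΘ : ∀ v κ, Θ (v, κ) = labelSum (extendLabels J v) + κ • pairFun p a b := fun v κ => rfl
  have hinj : Function.Injective Θ := by
    rw [← LinearMap.ker_eq_bot, LinearMap.ker_eq_bot']
    rintro ⟨v, κ⟩ hv
    rw [hΘ] at hv
    have hκ : κ = 0 := by
      have h₁ : labelSum (extendLabels J v) = 0 - κ • pairFun p a b := by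
        rw [← hv, add_sub_cancel_right]
      have h₂ := hlabel v
      rw [h₁, diffAt_sub_smul, show diffAt r₀ 0 x₀ = 0 by simp [diffAt], zero_sub,
        neg_eq_zero] at h₂
      exact (mul_eq_zero.1 h₂).resolve_right hpair
    rw [hκ, zero_smul, add_zero] at hv
    rw [hκ, eq_zero_of_extendLabels_eq_zero
      (eq_zero_of_labelSum_eq_zero hn2 (extendLabels_of_notMem v haJ) hv)]
    rfl
  have hrange : Module.End.eigenspace (transitionMatrix p).toLin' (1 - gapStar n) =
      LinearMap.range Θ := by
    ext f
    rw [mem_eigenspace_gapStar hn2 hp', LinearMap.mem_range]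
    constructor
    · intro hf
      -- Subtracting this multiple of `pairFun` kills the change for `(a, b)`, the only pair outside
      -- `J`.
      set κ := diffAt r₀ f x₀ / diffAt r₀ (pairFun p a b) x₀ with hκ
      have hg : ∑ r, coproj p r (f - κ • pairFun p a b) =
          (1 - Real.cos (Real.pi / n)) • (f - κ • pairFun p a b) := by
        simp only [coproj_sub_smul, sum_sub_distrib, ← smul_sum, hf,
          sum_coproj_pairFun hn2 hp' hab hJ]
        rw [smul_sub, smul_comm κ]
      have hx₀ : diffAt r₀ (f - κ • pairFun p a b) x₀ = 0 := by
        rw [diffAt_sub_smul, hκ, div_mul_cancel₀ _ hpair, sub_self]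
      have ht := isTight_of_eigenfunction hp hg
      have hv : VanishesOutside J (f - κ • pairFun p a b) r₀ := by
        intro x h₁ h₂
        have hne : x (leftPos r₀) ≠ x (rightPos r₀) := fun e =>
          leftPos_ne_rightPos r₀ (x.injective e)
        have h₁' : x (leftPos r₀) = a ∨ x (leftPos r₀) = b := by
          by_contra h; push Not at h; exact h₁ ((hmemJ _).2 h)
        have h₂' : x (rightPos r₀) = a ∨ x (rightPos r₀) = b := by
          by_contra h; push Not at h; exact h₂ ((hmemJ _).2 h)
        rcases h₁' with e₁ | e₁ <;> rcases h₂' with e₂ | e₂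
        · exact absurd (e₁.trans e₂.symm) hne
        · rw [← hx₀]
          exact ht.diffAt_zero_eq rfl (e₁.trans hxa.symm) (e₂.trans hxb.symm)
        · rw [← neg_eq_zero, ← diffAt_adjSwap, ← hx₀]
          exact ht.diffAt_zero_eq rfl (by rw [adjSwap_leftPos, e₂, hxa])
            (by rw [adjSwap_rightPos, e₁, hxb])
        · exact absurd (e₁.trans e₂.symm) hne
      obtain ⟨w, hw, h⟩ := exists_eq_labelSum hn hp hg hJ' haJ rfl hv
      obtain ⟨v, rfl⟩ := exists_extendLabels hw
      exact ⟨(v, κ), by rw [hΘ, ← h, sub_add_cancel]⟩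
    · rintro ⟨⟨v, κ⟩, rfl⟩
      have hw : ∀ c, ¬ IsNeutral p c → extendLabels J v c = 0 := fun c hc =>
        extendLabels_of_notMem v fun h => hc (hJ' c h)
      rw [hΘ, show labelSum (extendLabels J v) + κ • pairFun p a b =
        labelSum (extendLabels J v) - (-κ) • pairFun p a b by rw [neg_smul, sub_neg_eq_add]]
      simp only [coproj_sub_smul, sum_sub_distrib, ← smul_sum, sum_coproj_labelSum hn2 hw,
        sum_coproj_pairFun hn2 hp' hab hJ]
      rw [smul_sub, smul_comm (-κ)]
  have hcard : J.ncard = n - 2 := by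
    rw [hJdef, Set.ncard_compl, Nat.card_fin, Set.ncard_pair hab]
  rw [gapMultiplicity, rootMultiplicity_charpoly_eq_finrank hn2 hp', hrange,
    LinearMap.finrank_range_of_inj hinj, Module.finrank_prod, finrank_labels, hcard,
    Module.finrank_self]
  omega

theorem numNeutral_of_forall (hp : IsRegularParameterVector p) {lo hi : Fin n} (hne : lo ≠ hi)
    (hlo : ∀ i, lo ≤ i) (hhi : ∀ i, i ≤ hi) (hmid : ∀ c, c ≠ lo → c ≠ hi → IsNeutral p c) :
    numNeutral p = n - 2 ∨ numNeutral p = n := by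
  by_cases h : p lo hi = 1 / 2
  · right
    have : {c | IsNeutral p c} = Set.univ :=
      Set.eq_univ_of_forall fun c => hp.isNeutral_of_half hlo hhi h c
    rw [numNeutral, this, Set.ncard_univ, Nat.card_fin]
  · left
    have : {c | IsNeutral p c} = {lo, hi}ᶜ := by
      ext c
      simp only [Set.mem_ofPred_eq, Set.mem_compl_iff, Set.mem_insert_iff, Set.mem_singleton_iff,
        not_or]
      refine ⟨fun hc => ⟨?_, ?_⟩, fun hc => hmid c hc.1 hc.2⟩
      · rintro rfl
        exact h (hc.half_left hne.symm)
      · rintro rfl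
        exact h (hc.half_right hne)
    rw [numNeutral, this, Set.ncard_compl, Nat.card_fin, Set.ncard_pair hne]

/-- If the extreme labels are unbalanced, neither is neutral, so the neutral labels lie among the
other `n - 2` and the count makes them exhaust these. Otherwise monotonicity makes all labels
neutral. -/
theorem forall_isNeutral_of_numNeutral (hp : IsRegularParameterVector p) {lo hi : Fin n}
    (hne : lo ≠ hi) (hlo : ∀ i, lo ≤ i) (hhi : ∀ i, i ≤ hi)
    (h : numNeutral p = n - 2 ∨ numNeutral p = n) :
    ∀ c, c ≠ lo → c ≠ hi → IsNeutral p c := by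
  by_cases hhalf : p lo hi = 1 / 2
  · exact fun c _ _ => hp.isNeutral_of_half hlo hhi hhalf c
  have hsub : {c | IsNeutral p c} ⊆ {lo, hi}ᶜ := by
    intro c hc
    simp only [Set.mem_compl_iff, Set.mem_insert_iff, Set.mem_singleton_iff, not_or]
    constructor
    · rintro rfl
      exact hhalf (IsNeutral.half_left hc hne.symm)
    · rintro rfl
      exact hhalf (IsNeutral.half_right hc hne)
  have hcard : ({lo, hi}ᶜ : Set (Fin n)).ncard = n - 2 := by
    rw [Set.ncard_compl, Nat.card_fin, Set.ncard_pair hne]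
  have heq := Set.eq_of_subset_of_ncard_le hsub (by
    rw [hcard]
    rcases h with h | h <;> rw [numNeutral] at h <;> omega)
  intro c h₁ h₂
  have : c ∈ ({lo, hi}ᶜ : Set (Fin n)) := by simp [h₁, h₂]
  rw [← heq] at this
  exact this

end Multiplicity

theorem theorem1p1 (n : ℕ) (hn : 3 ≤ n) (p : Fin n → Fin n → ℝ) (hp : IsRegularParameterVector p) :
    (spectralGap p = gapStar n ↔ 1 ≤ numNeutral p) ∧
    (numNeutral p ≠ n - 2 ∧ numNeutral p ≠ n → gapMultiplicity p = numNeutral p) ∧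
    (numNeutral p = n - 2 ∨ numNeutral p = n → gapMultiplicity p = n - 1) := by
  let lo : Fin n := ⟨0, by omega⟩
  let hi : Fin n := ⟨n - 1, by omega⟩
  have hlo : ∀ i, lo ≤ i := fun i => Nat.zero_le _
  have hhi : ∀ i, i ≤ hi := fun i => by
    have := i.2
    exact Fin.le_def.2 (by simp only [hi]; omega)
  have hne : lo ≠ hi := fun h => by
    have := congrArg Fin.val h
    simp only [lo, hi] at this
    omega
  have h₁ : numNeutral p ≠ n - 2 ∧ numNeutral p ≠ n → gapMultiplicity p = numNeutral p := by
    rintro ⟨h, h'⟩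
    refine gapMultiplicity_of_exists_not_neutral hn hp hlo hhi ?_
    by_contra hcon
    push Not at hcon
    rcases numNeutral_of_forall hp hne hlo hhi hcon with e | e
    · exact h e
    · exact h' e
  have h₂ : numNeutral p = n - 2 ∨ numNeutral p = n → gapMultiplicity p = n - 1 := fun h =>
    gapMultiplicity_of_forall_neutral hn hp hne (forall_isNeutral_of_numNeutral hp hne hlo hhi h)
  refine ⟨?_, h₁, h₂⟩
  rw [spectralGap_eq_gapStar_iff hn hp]
  -- In the exceptional case both counts are positive because `n ≥ 3`.
  by_cases h : numNeutral p = n - 2 ∨ numNeutral p = n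
  · rw [h₂ h]
    rcases h with h | h <;> rw [h] <;> omega
  · push Not at h
    rw [h₁ h]
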